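/- A digraph $T$ is called a circulant tournament if, for some integer $m\ge 1$ and some set $J\subseteq\mathbb{Z}_{2m+1}\setminus\{0\}$ with $|J|=m$ and $|\{j,-j\}\cap J|=1$ for every $j\in J$, it is the digraph $\overrightarrow{C}_{2m+1}(J)$ with vertex set $\mathbb{Z}_{2m+1}$ and arcs the pairs $(i,j)$ with $j-i\in J$. The composition $D[F]$ of two digraphs is the digraph obtained from $D$ by replacing each vertex $v$ by a copy $F_v$ of $F$, with all arcs from $F_v$ to $F_w$ whenever $(v,w)$ is an arc of $D$. For a finite digraph $D$, let $\overrightarrow{\omega}_3(D)$ be the maximum number of connected components of the underlying graph of $D\setminus A(D^*)$, where $D^*$ ranges over the subdigraphs of $D$ that contain no directed triangle. A partition of $V(D)$ into nonempty classes is externally $\overrightarrow{C}_3$-free if the arcs of $D$ joining different classes contain no directed triangle; such a partition is optimal if it has exactly $\overrightarrow{\omega}_3(D)$ classes. The digraph $D$ is $\overrightarrow{\omega}_3$-keen if some optimal externally $\overrightarrow{C}_3$-free partition of $V(D)$ has exactly one class of cardinality one, and no externally $\overrightarrow{C}_3$-free partition of $V(D)$ has more than one such class. **Corollary.** Every composition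 of circulant tournaments is $\overrightarrow{\omega}_3$-keen. That is, if $T$ is isomorphic to $D[F]$, where each of $D$ and $F$ is a circulant tournament or is itself obtained from circulant tournaments by repeated composition, then $T$ is $\overrightarrow{\omega}_3$-keen. -/

import Mathlib

namespace Digraph

/-- `D` contains no directed triangle: there are no three distinct vertices `u, v, w` with arcs
`u → v → w → u`. -/
def IsC3Free {V : Type*} (D : Digraph V) : Prop :=
  ¬ ∃ u v w : V, u ≠ v ∧ v ≠ w ∧ w ≠ u ∧ D.Adj u v ∧ D.Adj v w ∧ D.Adj w u

/-- The directed-triangle-free disconnection of a (finite) digraph `D`: the maximum number of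
connected components of the underlying graph of `D \ A(D*)`, over all subdigraphs `D*` of `D`
without directed triangles. On a finite vertex set the set of these numbers is nonempty (take
`D* = ⊥`) and bounded by the number of vertices, so that `sSup` is a maximum. -/
noncomputable def omega3 {V : Type*} (D : Digraph V) : ℕ :=
  sSup {k : ℕ | ∃ S : Digraph V, S ≤ D ∧ S.IsC3Free ∧
    k = Nat.card (D \ S).toSimpleGraphInclusive.ConnectedComponent}

/-- The digraph formed by the external arcs of `D` with respect to the partition `π` of its
vertices: those with end vertices in different equivalence classes. -/
def externalArcs {V : Type*} (D : Digraph V) (π : Setoid V) : Digraph V where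
  Adj u v := D.Adj u v ∧ ¬ π u v

/-- `π` is an externally directed-triangle-free partition of the vertices of `D`. -/
def IsExternallyC3Free {V : Type*} (D : Digraph V) (π : Setoid V) : Prop :=
  (D.externalArcs π).IsC3Free

/-- The singular equivalence classes of a partition: those that are singletons. -/
def singularClasses {V : Type*} (π : Setoid V) : Set (Set V) :=
  {c | c ∈ π.classes ∧ ∃ v, c = {v}}

/-- An externally directed-triangle-free partition is optimal if its number of equivalence
classes is the directed-triangle-free disconnection. -/
def IsOptimalC3Free {V : Type*} (D : Digraph V) (π : Setoid V) : Prop :=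
  D.IsExternallyC3Free π ∧ π.classes.ncard = D.omega3

/-- A (finite) digraph is `ω₃`-keen if it has an optimal externally directed-triangle-free
partition with exactly one singular class, and no externally directed-triangle-free partition has
more than one singular class. -/
def IsOmega3Keen {V : Type*} (D : Digraph V) : Prop :=
  (∃ π : Setoid V, D.IsOptimalC3Free π ∧ (singularClasses π).ncard = 1) ∧
    ∀ π : Setoid V, D.IsExternallyC3Free π → (singularClasses π).ncard ≤ 1

/-- The composition (lexicographic product) `D[F]`: every vertex `v` of `D` is replaced by the copy
`{v} × F` of `F`. -/
def compose {V W : Type*} (D : Digraph V) (F : Digraph W) : Digraph (V × W) where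
  Adj x y := (x.1 = y.1 ∧ F.Adj x.2 y.2) ∨ D.Adj x.1 y.1

/-- `J` is the symbol set of a circulant tournament on `ℤ/(2m+1)`. -/
structure IsSymbolSet (m : ℕ) (J : Finset (ZMod (2 * m + 1))) : Prop where
  zero_notMem : (0 : ZMod (2 * m + 1)) ∉ J
  card_eq : J.card = m
  card_pair : ∀ j ∈ J, (({j, -j} : Finset (ZMod (2 * m + 1))) ∩ J).card = 1

/-- The circulant digraph on `ℤ/(2m+1)` with symbol set `J`: the arcs are the pairs `(i, j)` with
`j - i ∈ J`. It is a circulant tournament if `m` is positive and `IsSymbolSet m J` holds. -/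
def circulant (m : ℕ) (J : Finset (ZMod (2 * m + 1))) : Digraph (ZMod (2 * m + 1)) where
  Adj i j := j - i ∈ J

/-- The digraphs obtained from circulant tournaments by any number (possibly zero) of
compositions, in any bracketing. -/
inductive IsGeneratedByCirculants : {V : Type} → Digraph V → Prop
  | circulant (m : ℕ) (hm : 0 < m) (J : Finset (ZMod (2 * m + 1))) (hJ : IsSymbolSet m J) :
      IsGeneratedByCirculants (Digraph.circulant m J)
  | compose {V W : Type} (D : Digraph V) (F : Digraph W) (hD : IsGeneratedByCirculants D)
      (hF : IsGeneratedByCirculants F) : IsGeneratedByCirculants (D.compose F)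

/-- `T` is (isomorphic to) a composition of circulant tournaments: a composition `D[F]` where each
of `D`, `F` is a circulant tournament or again a composition of circulant tournaments. -/
def IsCompositionOfCirculants {V : Type*} (T : Digraph V) : Prop :=
  ∃ (X Y : Type) (D : Digraph X) (F : Digraph Y), IsGeneratedByCirculants D ∧
    IsGeneratedByCirculants F ∧ Nonempty (T.Adj ≃r (D.compose F).Adj)

end Digraph

/-! Compositions of Cayley tournaments on abelian groups are again such, on the product group. So it
suffices to treat a nontrivial finite abelian `G` with connection set `J`, where |G| = 2|J| + 1.
Partitions become colourings without rainbow directed triangles. Every arc lies in a directed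
triangle, so two singular classes would make some triangle external. What remains is an optimal
colouring with a colour used exactly once.

Induct on |G|. If a proper nontrivial subgroup `H` is a block, the tournament is a composition over
G/H and H, and optima k, l combine to k + l - 1 (`HasSingularOptimum.compose`). Otherwise the
tournament is prime, and two colours are the maximum (`ncard_range_le_two`), attained by one vertex
against the rest.

The prime case is isoperimetric. Put J₀ = J ∪ {0}. The method of atoms gives |X + J₀| ≥ |X| + |J|
for nonempty X unless X + J₀ = G (`card_add_card_le`). With three colour classes this forces a
singular one, {0} after translation. The other two colours then split J into P and Q with P + Q ⊆ J.
The sets P ∪ {0} and Q ∪ {0} are extremal; uncrossing yields an extremal pair {0, d}, which makes J₀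
a progression 0, d, …, nd. Then nd + x ∉ J for all x ∈ J, contradicting the split. -/

open scoped Pointwise

/-- `J` contains exactly one of `x`, `-x` for every nonzero `x`, and not `0`: the connection set of
a Cayley tournament on the abelian group `G`. -/
structure IsTournamentSet {G : Type*} [AddCommGroup G] (J : Set G) : Prop where
  zero_notMem : (0 : G) ∉ J
  neg_notMem : ∀ j ∈ J, -j ∉ J
  mem_or_neg_mem : ∀ x, x ≠ 0 → x ∈ J ∨ -x ∈ J

/-- `H` is a block of the Cayley tournament of `J`: `J \ H` is a union of cosets of `H`. -/
def IsModuleSubgroup {G : Type*} [AddCommGroup G] (J : Set G) (H : AddSubgroup G) : Prop :=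
  ∀ j ∈ J, j ∉ H → ∀ h ∈ H, j + h ∈ J

/-- The Cayley tournament of `J` has no nontrivial blocks that are subgroups. -/
def IsPrimeSet {G : Type*} [AddCommGroup G] (J : Set G) : Prop :=
  ∀ H : AddSubgroup G, IsModuleSubgroup J H → H = ⊥ ∨ H = ⊤

namespace IsTournamentSet

/-! ### Connection sets of tournaments -/

section Basic

variable {G : Type*} [AddCommGroup G] {J : Set G}

theorem ne_zero (hJ : IsTournamentSet J) {x : G} (hx : x ∈ J) : x ≠ 0 :=
  fun h => hJ.zero_notMem (h ▸ hx)

theorem add_ne_zero (hJ : IsTournamentSet J) {x y : G} (hx : x ∈ J) (hy : y ∈ J) : x + y ≠ 0 := by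
  intro h
  exact hJ.neg_notMem x hx (by rwa [neg_eq_of_add_eq_zero_right h])

theorem add_mem (hJ : IsTournamentSet J) {x y : G} (hx : x ∈ J) (hy : y ∈ J)
    (h : -(x + y) ∉ J) : x + y ∈ J :=
  (hJ.mem_or_neg_mem _ (hJ.add_ne_zero hx hy)).resolve_right h

/-- Every arc of a finite Cayley tournament lies in a directed triangle. -/
theorem exists_neg_add_mem [Finite G] (hJ : IsTournamentSet J) {i : G} (hi : i ∈ J) :
    ∃ j ∈ J, -(i + j) ∈ J := by
  by_contra! h
  -- Without a triangle through `i`, the set `J` is closed under adding `i`, so it contains all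
  -- positive multiples of `i`, including 0.
  have key : ∀ n : ℕ, (n + 1) • i ∈ J := by
    intro n
    induction n with
    | zero => simpa using hi
    | succ n ih =>
      rw [succ_nsmul']
      exact hJ.add_mem hi ih (h _ ih)
  have := key (addOrderOf i - 1)
  rw [Nat.sub_add_cancel (addOrderOf_pos i), addOrderOf_nsmul_eq_zero] at this
  exact hJ.zero_notMem this

end Basic

/-! ### Isoperimetry in prime Cayley tournaments -/

section Isoperimetry

variable {G : Type*} [AddCommGroup G] [DecidableEq G] {J : Finset G}

theorem two_mul_card_add_one [Fintype G] (hJ : IsTournamentSet (J : Set G)) :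
    2 * J.card + 1 = Fintype.card G := by
  have h1 : insert 0 (J ∪ -J) = (Finset.univ : Finset G) := by
    ext x
    simp only [Finset.mem_insert, Finset.mem_union, Finset.mem_neg', Finset.mem_univ, iff_true]
    by_cases hx : x = 0
    · exact Or.inl hx
    · exact Or.inr (by simpa using hJ.mem_or_neg_mem x hx)
  have h2 : Disjoint J (-J) := by
    rw [Finset.disjoint_left]
    intro x hx hx'
    exact hJ.neg_notMem x (by simpa using hx) (by simpa using hx')
  have h3 : (0 : G) ∉ J ∪ -J := by
    have := hJ.zero_notMem
    simp at this
    simp [this]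
  rw [← Finset.card_univ, ← h1, Finset.card_insert_of_notMem h3, Finset.card_union_of_disjoint h2,
    Finset.card_neg]
  ring

theorem subset_add_insert_zero (X : Finset G) : X ⊆ X + insert 0 J := by
  intro x hx
  exact Finset.mem_add.2 ⟨x, hx, 0, by simp, by simp⟩

/-- Submodularity, which allows extremal sets to be uncrossed. -/
theorem card_add_inter_add_card_add_union (X Y : Finset G) :
    ((X ∩ Y) + insert 0 J).card + ((X ∪ Y) + insert 0 J).card ≤
      (X + insert 0 J).card + (Y + insert 0 J).card := by
  rw [Finset.union_add, add_comm, ← Finset.card_union_add_card_inter (X + insert 0 J)]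
  exact Nat.add_le_add_left (Finset.card_le_card Finset.inter_add_subset) _

/-- A subgroup whose closed out-neighbourhood is small is a block. -/
theorem isModuleSubgroup_of_card_lt [Fintype G] (hJ : IsTournamentSet (J : Set G)) (H : AddSubgroup G)
    (X : Finset G) (hX : (X : Set G) = H) (h : (X + insert 0 J).card < X.card + J.card) :
    IsModuleSubgroup (J : Set G) H := by
  intro j hj hjH a ha
  by_contra hja
  have hXH : ∀ x, x ∈ X ↔ x ∈ H := fun x => by rw [← Finset.mem_coe, hX]; rfl
  have hne : j + a ≠ 0 := fun h0 => hjH (by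
    rw [eq_neg_of_add_eq_zero_left h0]; exact H.neg_mem ha)
  have hneg : -(j + a) ∈ J := by simpa using (hJ.mem_or_neg_mem _ hne).resolve_left hja
  -- `W` and `-W` cover `G` and overlap in `H` and, since `-(j + a) ∈ J`, in the disjoint coset `j +
  -- H`. Hence 2|W| ≥ |G| + 2|H|, which is too large.
  set W := X + insert 0 J with hW
  have hmem : ∀ x ∈ H, ∀ i ∈ J, x + i ∈ W := fun x hx i hi =>
    Finset.add_mem_add ((hXH x).2 hx) (Finset.mem_insert_of_mem hi)
  have hunion : W ∪ -W = Finset.univ := by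
    ext x
    simp only [Finset.mem_union, Finset.mem_neg', Finset.mem_univ, iff_true]
    by_cases hx : x = 0
    · left; subst hx; exact subset_add_insert_zero X ((hXH 0).2 H.zero_mem)
    · rcases hJ.mem_or_neg_mem x hx with h | h
      · left; simpa using hmem 0 H.zero_mem x (by simpa using h)
      · right; simpa using hmem 0 H.zero_mem (-x) (by simpa using h)
  have hinter : X ∪ X.image (j + ·) ⊆ W ∩ -W := by
    intro x hx
    rw [Finset.mem_inter, Finset.mem_neg']
    rcases Finset.mem_union.1 hx with hx | hx
    · exact ⟨subset_add_insert_zero X hx,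
        subset_add_insert_zero X ((hXH _).2 (H.neg_mem ((hXH x).1 hx)))⟩
    · obtain ⟨b, hb, rfl⟩ := Finset.mem_image.1 hx
      have hb := (hXH b).1 hb
      refine ⟨by rw [add_comm]; exact hmem b hb j (by simpa using hj), ?_⟩
      have : -(j + b) = (a - b) + -(j + a) := by abel
      rw [this]
      exact hmem _ (H.sub_mem ha hb) _ hneg
  have hdisj : Disjoint X (X.image (j + ·)) := by
    rw [Finset.disjoint_left]
    intro x hx hx'
    obtain ⟨b, hb, rfl⟩ := Finset.mem_image.1 hx'
    exact hjH ((H.add_mem_cancel_right ((hXH b).1 hb)).1 ((hXH _).1 hx))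
  have h1 := Finset.card_le_card hinter
  rw [Finset.card_union_of_disjoint hdisj,
    Finset.card_image_of_injective _ (add_right_injective j)] at h1
  have h2 := Finset.card_union_add_card_inter W (-W)
  rw [hunion, Finset.card_univ, Finset.card_neg, ← hJ.two_mul_card_add_one] at h2
  omega

/-- Closed out-neighbourhoods in a prime Cayley tournament are as large as possible. -/
theorem card_add_card_le [Fintype G] (hJ : IsTournamentSet (J : Set G)) (hp : IsPrimeSet (J : Set G))
    {X : Finset G} (hX : X.Nonempty) (hne : X + insert 0 J ≠ Finset.univ) :
    X.card + J.card ≤ (X + insert 0 J).card := by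
  by_contra! hlt
  let S : Finset (Finset G) :=
    Finset.univ.filter fun Y => Y.Nonempty ∧ Y + insert 0 J ≠ Finset.univ
  have hS : ∀ Y, Y ∈ S ↔ Y.Nonempty ∧ Y + insert 0 J ≠ Finset.univ := fun Y => by simp [S]
  -- The set `Y` below is an atom: smallest among the sets of minimal boundary `δ`. It turns out to
  -- be a coset of a subgroup.
  let δ : Finset G → ℕ := fun Y => (Y + insert 0 J).card - Y.card
  have hδ : ∀ Y : Finset G, (Y + insert 0 J).card = Y.card + δ Y := fun Y => by
    have := Finset.card_le_card (subset_add_insert_zero (J := J) Y)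
    simp only [δ]; omega
  obtain ⟨Y0, hY0, hmin0⟩ := S.exists_min_image δ ⟨X, (hS X).2 ⟨hX, hne⟩⟩
  obtain ⟨Y, hY, hminY⟩ := (S.filter fun Y => δ Y = δ Y0).exists_min_image Finset.card
    ⟨Y0, by simp [hY0]⟩
  rw [Finset.mem_filter] at hY
  have hmin : ∀ Z ∈ S, δ Y ≤ δ Z := fun Z hZ => hY.2 ▸ hmin0 Z hZ
  have hmin' : ∀ Z ∈ S, δ Z ≤ δ Y → Y.card ≤ Z.card := fun Z hZ h =>
    hminY Z (Finset.mem_filter.2 ⟨hZ, le_antisymm (hY.2 ▸ h) (hmin0 Z hZ)⟩)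
  obtain ⟨hYS, -⟩ := hY
  obtain ⟨hYne, hYuniv⟩ := (hS Y).1 hYS
  have hδlt : δ Y < J.card := by
    have h1 := hmin X ((hS X).2 ⟨hX, hne⟩)
    have h2 := hδ X
    omega
  -- The reflected complement `Z` of the neighbourhood of `Y` has boundary at most `δ Y`, so |Y| ≤
  -- |Z| = |G| - |Y| - `δ Y`. This serves when a union below has full neighbourhood.
  have hdual : 2 * Y.card + δ Y ≤ Fintype.card G := by
    set Z := -(Y + insert 0 J)ᶜ with hZ
    have hZcard : Z.card + (Y + insert 0 J).card = Fintype.card G := by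
      rw [hZ, Finset.card_neg, Finset.card_compl]
      have := Finset.card_le_univ (Y + insert 0 J)
      omega
    have hsub : Z + insert 0 J ⊆ -Yᶜ := by
      intro x hx
      obtain ⟨z, hz, j, hj, rfl⟩ := Finset.mem_add.1 hx
      rw [Finset.mem_neg', Finset.mem_compl]
      intro hy
      rw [hZ, Finset.mem_neg', Finset.mem_compl] at hz
      exact hz (Finset.mem_add.2 ⟨_, hy, j, hj, by abel⟩)
    have hcard := Finset.card_le_card hsub
    rw [Finset.card_neg, Finset.card_compl] at hcard
    have hYle := Finset.card_le_univ Y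
    have hYpos := hYne.card_pos
    have hZS : Z ∈ S := by
      refine (hS Z).2 ⟨?_, fun hu => ?_⟩
      · rw [hZ, Finset.neg_nonempty_iff, Finset.nonempty_iff_ne_empty, ne_eq,
          Finset.compl_eq_empty_iff]
        exact hYuniv
      · rw [hu, Finset.card_univ] at hcard
        omega
    have h1 := hδ Y
    have h2 := hδ Z
    have h3 := hmin' Z hZS (by omega)
    omega
  have htrans : ∀ g : G, ∀ Z : Finset G, (Z.image (g + ·)) + insert 0 J =
      (Z + insert 0 J).image (g + ·) := by
    intro g Z
    have : ∀ U : Finset G, U.image (g + ·) = {g} + U := fun U => by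
      rw [Finset.singleton_add]; rfl
    rw [this, this, add_assoc]
  -- By submodularity the intersection is again a minimiser of `δ`, hence all of `Y`.
  have hblock : ∀ g : G, (Y ∩ Y.image (g + ·)).Nonempty → Y ⊆ Y.image (g + ·) := by
    intro g hg
    set Y' := Y.image (g + ·) with hY'
    have hc' : Y'.card = Y.card := Finset.card_image_of_injective _ (add_right_injective g)
    have hc'' : (Y' + insert 0 J).card = (Y + insert 0 J).card := by
      rw [hY', htrans]; exact Finset.card_image_of_injective _ (add_right_injective g)
    have hmain := card_add_inter_add_card_add_union (J := J) Y Y'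
    have hcc := Finset.card_union_add_card_inter Y Y'
    have hIS : Y ∩ Y' ∈ S := by
      refine (hS _).2 ⟨hg, fun hu => hYuniv ?_⟩
      rw [← Finset.univ_subset_iff, ← hu]
      exact Finset.add_subset_add_right Finset.inter_subset_left
    have h1 := hmin _ hIS
    have h2 := hδ (Y ∩ Y')
    have h3 := hδ Y
    have hpos := hg.card_pos
    have h5 : δ (Y ∩ Y') ≤ δ Y := by
      by_cases hu : (Y ∪ Y') + insert 0 J = Finset.univ
      · rw [hu, Finset.card_univ] at hmain
        omega
      · have hUS : Y ∪ Y' ∈ S := (hS _).2 ⟨hYne.mono Finset.subset_union_left, hu⟩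
        have h6 := hmin _ hUS
        have h7 := hδ (Y ∪ Y')
        omega
    have h8 := hmin' _ hIS h5
    have h9 : Y ∩ Y' = Y := Finset.eq_of_subset_of_card_le Finset.inter_subset_left h8
    rw [← h9]
    exact Finset.inter_subset_right
  obtain ⟨y, hy⟩ := hYne
  have hsubm : ∀ a ∈ Y, ∀ b ∈ Y, ∀ c ∈ Y, c + (a - b) ∈ Y := by
    intro a ha b hb c hc
    have h1 : Y ⊆ Y.image ((b - a) + ·) := hblock (b - a) ⟨b, Finset.mem_inter.2 ⟨hb,
      Finset.mem_image.2 ⟨a, ha, by abel⟩⟩⟩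
    obtain ⟨d, hd, hdc⟩ := Finset.mem_image.1 (h1 hc)
    have : c + (a - b) = d := by rw [← hdc]; abel
    rwa [this]
  let H : AddSubgroup G :=
    { carrier := {x | y + x ∈ Y}
      zero_mem' := by simpa using hy
      add_mem' := by
        intro a b ha hb
        have := hsubm _ hb y hy _ ha
        simpa [add_assoc] using this
      neg_mem' := by
        intro a ha
        have := hsubm y hy _ ha y hy
        simpa [sub_eq_add_neg] using this }
  have hXH : ((Y.image ((-y) + ·) : Finset G) : Set G) = H := by
    ext x
    simp only [Finset.coe_image, Set.mem_image, Finset.mem_coe]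
    constructor
    · rintro ⟨z, hz, rfl⟩
      change y + (-y + z) ∈ Y
      simpa using hz
    · intro hx
      exact ⟨y + x, hx, by abel⟩
  have hcard1 : (Y.image ((-y) + ·)).card = Y.card :=
    Finset.card_image_of_injective _ (add_right_injective (-y))
  have hcard2 : (Y.image ((-y) + ·) + insert 0 J).card = Y.card + δ Y := by
    rw [htrans, Finset.card_image_of_injective _ (add_right_injective (-y)), hδ]
  have hmod := hJ.isModuleSubgroup_of_card_lt H _ hXH (by rw [hcard1, hcard2]; omega)
  -- `H = ⊥` would give `δ Y` = |J|, and `H = ⊤` would give `Y` = G; both are excluded.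
  rcases hp H hmod with h | h
  · rw [h] at hXH
    have h1 : Y.image ((-y) + ·) = {0} := by
      rw [← Finset.coe_inj, hXH]; simp
    rw [h1, Finset.singleton_add] at hcard2
    rw [h1, Finset.card_singleton] at hcard1
    have h0 : (0 : G) ∉ J := by simpa using hJ.zero_notMem
    simp only [zero_vadd, Finset.card_insert_of_notMem h0] at hcard2
    omega
  · rw [h] at hXH
    have h1 : Y.image ((-y) + ·) = Finset.univ := by
      rw [← Finset.coe_inj, hXH]; simp
    apply hYuniv
    rw [← Finset.univ_subset_iff]
    refine Finset.Subset.trans ?_ (subset_add_insert_zero Y)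
    rw [Finset.univ_subset_iff, ← Finset.card_eq_iff_eq_univ, ← hcard1, h1, Finset.card_univ]

/-- In a prime Cayley tournament, if all arcs between `Y` and `X` go from `Y` to `X`, then
`|X| + |Y|` is at most the size of a closed out-neighbourhood. -/
theorem card_add_card_le_of_dominates [Fintype G] (hJ : IsTournamentSet (J : Set G))
    (hp : IsPrimeSet (J : Set G)) {X Y : Finset G} (hX : X.Nonempty) (hY : Y.Nonempty)
    (h : ∀ y ∈ Y, ∀ x ∈ X, x - y ∈ J) : X.card + Y.card ≤ J.card + 1 := by
  -- No arc leads from `X` to `Y` and the sets are disjoint, so the closed out-neighbourhood of `X`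
  -- avoids `Y`.
  have hsub : X + insert 0 J ⊆ Yᶜ := by
    intro z hz
    rw [Finset.mem_compl]
    intro hzY
    obtain ⟨x, hx, j, hj, rfl⟩ := Finset.mem_add.1 hz
    have h1 := h _ hzY x hx
    rw [sub_add_cancel_left] at h1
    rcases Finset.mem_insert.1 hj with rfl | hj
    · exact hJ.zero_notMem (by simpa using h1)
    · exact hJ.neg_notMem j (by simpa using hj) (by simpa using h1)
  have h1 := Finset.card_le_card hsub
  rw [Finset.card_compl] at h1
  have h2 := hY.card_pos
  have h3 := Finset.card_le_univ Y
  have h4 := hJ.two_mul_card_add_one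
  have h5 := hJ.card_add_card_le hp hX (fun hu => by
    rw [hu, Finset.card_univ] at h1
    omega)
  omega

end Isoperimetry

end IsTournamentSet

namespace IsTournamentSet

/-! ### Fragments and splits of the connection set -/

section Fragments

variable {G : Type*} [AddCommGroup G] [DecidableEq G] {J : Finset G}

/-- A partition of a connection set into two parts such that all directed triangles of the Cayley
tournament have their differences in the same part. -/
structure IsSplit (J P Q : Finset G) : Prop where
  union_eq : P ∪ Q = J
  disjoint : Disjoint P Q
  left_nonempty : P.Nonempty
  right_nonempty : Q.Nonempty
  add_mem : ∀ p ∈ P, ∀ q ∈ Q, p + q ∈ J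

namespace IsSplit

variable {P Q : Finset G}

theorem symm (h : IsSplit J P Q) : IsSplit J Q P :=
  ⟨by rw [Finset.union_comm, h.union_eq], h.disjoint.symm, h.right_nonempty, h.left_nonempty,
    fun q hq p hp => by rw [add_comm]; exact h.add_mem p hp q hq⟩

theorem mem_iff (h : IsSplit J P Q) {x : G} : x ∈ J ↔ x ∈ P ∨ x ∈ Q := by
  rw [← h.union_eq, Finset.mem_union]

end IsSplit

variable [Fintype G]

/-- A nonempty set whose closed out-neighbourhood is not everything and is as small as the prime
case permits. -/
structure IsFragment (J X : Finset G) : Prop where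
  nonempty : X.Nonempty
  ne_univ : X + insert 0 J ≠ Finset.univ
  card_le : (X + insert 0 J).card ≤ X.card + J.card

/-- Submodularity, with `card_add_card_le` for the union. If the union has full neighbourhood, |X ∪
Y| ≤ |J| and |G| = 2|J| + 1 replace that bound. -/
theorem IsFragment.inter (hJ : IsTournamentSet (J : Set G)) (hp : IsPrimeSet (J : Set G))
    {X Y : Finset G} (hX : IsFragment J X) (hY : IsFragment J Y) (hne : (X ∩ Y).Nonempty)
    (hc : (X ∪ Y).card ≤ J.card) : IsFragment J (X ∩ Y) := by
  refine ⟨hne, fun hu => hX.ne_univ ?_, ?_⟩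
  · rw [← Finset.univ_subset_iff, ← hu]
    exact Finset.add_subset_add_right Finset.inter_subset_left
  · have h1 := card_add_inter_add_card_add_union (J := J) X Y
    have h2 := Finset.card_union_add_card_inter X Y
    have h3 := hX.card_le
    have h4 := hY.card_le
    by_cases hu : (X ∪ Y) + insert 0 J = Finset.univ
    · rw [hu, Finset.card_univ, ← hJ.two_mul_card_add_one] at h1
      omega
    · have := hJ.card_add_card_le hp (hX.nonempty.mono Finset.subset_union_left) hu
      omega

theorem IsFragment.vadd {X : Finset G} (hX : IsFragment J X) (g : G) :
    IsFragment J (g +ᵥ X) := by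
  have h : (g +ᵥ X) + insert 0 J = g +ᵥ (X + insert 0 J) := vadd_add_assoc _ _ _
  refine ⟨by simpa using hX.nonempty, fun hu => hX.ne_univ ?_, ?_⟩
  · rw [← Finset.card_eq_iff_eq_univ, ← Finset.card_vadd_finset g, ← h, hu, Finset.card_univ]
  · rw [h, Finset.card_vadd_finset, Finset.card_vadd_finset]
    exact hX.card_le

namespace IsSplit

variable {P Q : Finset G}

/-- The neighbourhood lies in J₀ ∪ -P: if p + y ∉ J with p ∈ P and y ∈ J, then -(p + y) ∈ J, and it
is not in Q because adding p would give -y ∈ J. -/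
theorem isFragment_insert_zero (h : IsSplit J P Q) (hJ : IsTournamentSet (J : Set G)) :
    IsFragment J (insert 0 P) := by
  have h0 : (0 : G) ∉ P := fun h0 => hJ.zero_notMem (h.mem_iff.2 (Or.inl h0))
  have h0J : (0 : G) ∉ J := hJ.zero_notMem
  have hsub : insert 0 P + insert 0 J ⊆ insert 0 J ∪ -P := by
    intro z hz
    obtain ⟨x, hx, y, hy, rfl⟩ := Finset.mem_add.1 hz
    rw [Finset.mem_union, Finset.mem_neg']
    rcases Finset.mem_insert.1 hx with rfl | hx
    · left; simpa using hy
    have hxJ := h.mem_iff.2 (Or.inl hx)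
    rcases Finset.mem_insert.1 hy with rfl | hy
    · left; simp [hxJ]
    by_cases hneg : -(x + y) ∈ (J : Set G)
    · right
      refine (h.mem_iff.1 hneg).resolve_right fun hq => ?_
      have := h.add_mem x hx _ hq
      rw [show x + -(x + y) = -y by abel] at this
      exact hJ.neg_notMem y hy this
    · left
      exact Finset.mem_insert_of_mem (hJ.add_mem hxJ hy hneg)
  refine ⟨by simp, fun hu => ?_, ?_⟩
  · obtain ⟨q, hq⟩ := h.right_nonempty
    have hqJ := h.mem_iff.2 (Or.inr hq)
    rw [hu] at hsub
    have := hsub (Finset.mem_univ (-q))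
    rw [Finset.mem_union, Finset.mem_neg', neg_neg, Finset.mem_insert, neg_eq_zero] at this
    rcases this with (rfl | hm) | hm
    · exact h0J hqJ
    · exact hJ.neg_notMem q hqJ hm
    · exact Finset.disjoint_left.1 h.disjoint hm hq
  · have h1 := Finset.card_le_card hsub
    have h2 := Finset.card_union_le (insert 0 J) (-P)
    rw [Finset.card_neg, Finset.card_insert_of_notMem h0J] at h2
    rw [Finset.card_insert_of_notMem h0]
    omega

/-- A split of a prime connection set yields a fragment with two elements. -/
theorem exists_isFragment_pair (h : IsSplit J P Q) (hJ : IsTournamentSet (J : Set G))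
    (hp : IsPrimeSet (J : Set G)) : ∃ d ∈ J, IsFragment J {0, d} := by
  wlog hPQ : Q.card ≤ P.card generalizing P Q
  · exact this h.symm (by omega)
  have h0J : (0 : G) ∉ J := hJ.zero_notMem
  have h0P : (0 : G) ∉ P := fun h0 => h0J (h.mem_iff.2 (Or.inl h0))
  have h0Q : (0 : G) ∉ Q := fun h0 => h0J (h.mem_iff.2 (Or.inr h0))
  have hP := h.isFragment_insert_zero hJ
  have hQ := h.symm.isFragment_insert_zero hJ
  have hcard : P.card + Q.card = J.card := by
    rw [← h.union_eq, Finset.card_union_of_disjoint h.disjoint]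
  have hQ2 : 2 ≤ (insert 0 Q).card := by
    rw [Finset.card_insert_of_notMem h0Q]
    have := h.right_nonempty.card_pos
    omega
  classical
  obtain ⟨K, hK, hmin⟩ := (Finset.univ.filter fun X : Finset G =>
    IsFragment J X ∧ 2 ≤ X.card).exists_min_image Finset.card ⟨insert 0 Q, by simp [hQ, hQ2]⟩
  simp only [Finset.mem_filter, Finset.mem_univ, true_and] at hK hmin
  obtain ⟨hK, hK2⟩ := hK
  have hKQ := hmin _ ⟨hQ, hQ2⟩
  rw [Finset.card_insert_of_notMem h0Q] at hKQ
  -- Two common points bound the union by (|Q| + 1) + (|P| + 1) - 2 = |J|, so the intersection is a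
  -- fragment and minimality of `K` applies.
  have closed : ∀ X : Finset G, IsFragment J X → X.card ≤ P.card + 1 → ∀ g : G,
      ∀ x ∈ (g +ᵥ K) ∩ X, ∀ y ∈ (g +ᵥ K) ∩ X, x ≠ y → g +ᵥ K ⊆ X := by
    intro X hX hXc g x hx y hy hxy
    have h2 : 2 ≤ ((g +ᵥ K) ∩ X).card := Finset.one_lt_card.2 ⟨x, hx, y, hy, hxy⟩
    have hu := Finset.card_union_add_card_inter (g +ᵥ K) X
    rw [Finset.card_vadd_finset] at hu
    have hI := (hK.vadd g).inter hJ hp hX ⟨x, hx⟩ (by omega)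
    have hle := hmin _ ⟨hI, h2⟩
    have heq : (g +ᵥ K) ∩ X = g +ᵥ K := Finset.eq_of_subset_of_card_le Finset.inter_subset_left
      (by rwa [Finset.card_vadd_finset])
    rw [← heq]
    exact Finset.inter_subset_right
  -- The translate of `K` by `-k` has two points in P ∪ {0} or in Q ∪ {0}, so it lies inside. Thus
  -- each vertex of `K` is a source or a sink of `K`, which leaves room for only two vertices.
  have source : ∀ k ∈ K, ∀ l ∈ K, l - k ∈ J → ∀ x ∈ K, x ≠ k → x - k ∈ J := by
    intro k hk l hl hlk x hx hxk
    have hm : ∀ y ∈ K, y - k ∈ (-k) +ᵥ K := fun y hy =>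
      Finset.mem_vadd_finset.2 ⟨y, hy, by simp [sub_eq_neg_add]⟩
    have h0 : (0 : G) ∈ (-k) +ᵥ K := by simpa using hm k hk
    have hne : (0 : G) ≠ l - k := fun h0 => h0J (h0 ▸ hlk)
    have hxk' : x - k ≠ 0 := sub_ne_zero.2 hxk
    rcases h.mem_iff.1 hlk with hlP | hlQ
    · have := closed _ hP (by rw [Finset.card_insert_of_notMem h0P]) (-k) 0
        (by simp [h0]) (l - k) (by simp only [Finset.mem_inter, Finset.mem_insert, hm l hl, hlP,
          or_true, and_self]) hne (hm x hx)
      exact h.mem_iff.2 (Or.inl (Finset.mem_of_mem_insert_of_ne this hxk'))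
    · have := closed _ hQ (by rw [Finset.card_insert_of_notMem h0Q]; omega) (-k) 0
        (by simp [h0]) (l - k) (by simp only [Finset.mem_inter, Finset.mem_insert, hm l hl, hlQ,
          or_true, and_self]) hne (hm x hx)
      exact h.mem_iff.2 (Or.inr (Finset.mem_of_mem_insert_of_ne this hxk'))
  have asym : ∀ x y : G, x - y ∈ J → y - x ∉ J := by
    intro x y hxy hyx
    exact hJ.neg_notMem _ hxy (by simpa using hyx)
  have total : ∀ x y : G, x ≠ y → x - y ∈ J ∨ y - x ∈ J := by
    intro x y hxy
    simpa using hJ.mem_or_neg_mem (x - y) (sub_ne_zero.2 hxy)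
  have hle2 : K.card ≤ 2 := by
    by_contra! h3
    obtain ⟨a, b, c, ha, hb, hc, hab, hac, hbc⟩ := Finset.two_lt_card_iff.1 h3
    have key : ∀ a ∈ K, ∀ b ∈ K, ∀ c ∈ K, a ≠ c → b ≠ c → b - a ∈ J → False := by
      intro a ha b hb c hc hac hbc hba
      have hab : a ≠ b := fun hab => h0J (by simpa [hab] using hba)
      have hca := source a ha b hb hba c hc hac.symm
      rcases total b c hbc with h1 | h1
      · exact asym _ _ hca (source c hc b hb h1 a ha hac)
      · exact asym _ _ hba (source b hb c hc h1 a ha hab)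
    rcases total a b hab with h1 | h1
    · exact key b hb a ha c hc hbc hac h1
    · exact key a ha b hb c hc hac hbc h1
  obtain ⟨x, y, hxy, rfl⟩ := Finset.card_eq_two.1 (le_antisymm hle2 hK2)
  rcases total x y hxy with h1 | h1
  · refine ⟨x - y, h1, ?_⟩
    have := hK.vadd (-y)
    rwa [show (-y) +ᵥ ({x, y} : Finset G) = {0, x - y} by
      rw [Finset.pair_comm x y]
      simp [Finset.vadd_finset_insert, sub_eq_neg_add]] at this
  · refine ⟨y - x, h1, ?_⟩
    have := hK.vadd (-x)
    rwa [show (-x) +ᵥ ({x, y} : Finset G) = {0, y - x} by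
      simp [Finset.vadd_finset_insert, sub_eq_neg_add]] at this

/-- Adding d moves only one element out of J₀, so J₀ is a progression 0, d, …, nd together with full
cosets of ⟨d⟩. Then ⟨d⟩ is a block, primeness gives ⟨d⟩ = G, and only the progression remains. Its
last term has no sum with an element of J inside J. -/
theorem not_isPrimeSet (h : IsSplit J P Q) (hJ : IsTournamentSet (J : Set G)) :
    ¬ IsPrimeSet (J : Set G) := by
  intro hp
  obtain ⟨d, hd, hfrag⟩ := h.exists_isFragment_pair hJ hp
  have h0J : (0 : G) ∉ J := hJ.zero_notMem
  have hd0 : d ≠ 0 := fun h0 => h0J (h0 ▸ hd)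
  set J0 : Finset G := insert 0 J with hJ0
  have hzero : (0 : G) ∈ J0 := Finset.mem_insert_self _ _
  have hmemJ : ∀ x ∈ J0, x ≠ 0 → x ∈ J := fun x hx hx0 => Finset.mem_of_mem_insert_of_ne hx hx0
  have hnegd : -d ∉ J0 := by
    rw [hJ0, Finset.mem_insert, neg_eq_zero]
    rintro (h1 | h1)
    · exact hd0 h1
    · exact hJ.neg_notMem d hd h1
  have hunion : ({0, d} : Finset G) + J0 = J0 ∪ (d +ᵥ J0) := by
    rw [Finset.insert_eq, Finset.union_add, Finset.singleton_add, Finset.singleton_add, zero_vadd]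
  have hcardJ0 : J0.card = J.card + 1 := Finset.card_insert_of_notMem h0J
  have hcd : ((d +ᵥ J0) \ J0).card ≤ 1 := by
    have h1 := hfrag.card_le
    rw [← hJ0, hunion, ← Finset.union_sdiff_self_eq_union,
      Finset.card_union_of_disjoint Finset.disjoint_sdiff,
      Finset.card_pair hd0.symm] at h1
    omega
  have hce : (J0 \ (d +ᵥ J0)).card ≤ 1 := by
    have h1 := Finset.card_sdiff_add_card_inter J0 (d +ᵥ J0)
    have h2 := Finset.card_sdiff_add_card_inter (d +ᵥ J0) J0
    rw [Finset.card_vadd_finset, Finset.inter_comm] at h2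
    omega
  have exit_unique : ∀ x ∈ J0, d + x ∉ J0 → ∀ y ∈ J0, d + y ∉ J0 → x = y := by
    intro x hx hx' y hy hy'
    refine add_left_cancel (Finset.card_le_one.1 hcd (d + x) ?_ (d + y) ?_)
    · exact Finset.mem_sdiff.2 ⟨Finset.mem_vadd_finset.2 ⟨x, hx, rfl⟩, hx'⟩
    · exact Finset.mem_sdiff.2 ⟨Finset.mem_vadd_finset.2 ⟨y, hy, rfl⟩, hy'⟩
  -- J₀ and d + J₀ have equal size, so only one element of J₀ is missing from d + J₀, and 0 is one
  -- since -d ∉ J₀.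
  have pred_mem : ∀ x ∈ J0, x ≠ 0 → x - d ∈ J0 := by
    intro x hx hx0
    by_contra hxd
    refine hx0 (Finset.card_le_one.1 hce x ?_ 0 ?_)
    · refine Finset.mem_sdiff.2 ⟨hx, fun hm => hxd ?_⟩
      obtain ⟨y, hy, rfl⟩ := Finset.mem_vadd_finset.1 hm
      simpa using hy
    · refine Finset.mem_sdiff.2 ⟨hzero, fun hm => hnegd ?_⟩
      obtain ⟨y, hy, hy0⟩ := Finset.mem_vadd_finset.1 hm
      rwa [neg_eq_of_add_eq_zero_right hy0]
  have hex : ∃ n : ℕ, (n + 1) • d ∉ J0 := by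
    by_contra! hall
    refine hnegd ?_
    have h1 : -d ∈ AddSubmonoid.multiples d :=
      (mem_multiples_iff_mem_zmultiples).2 (neg_mem (AddSubgroup.mem_zmultiples d))
    obtain ⟨n, hn⟩ := AddSubmonoid.mem_multiples_iff _ _ |>.1 h1
    rw [← hn]
    cases n with
    | zero => simp [hzero]
    | succ n => exact hall n
  classical
  let n := Nat.find hex
  have hn : (n + 1) • d ∉ J0 := Nat.find_spec hex
  have hle : ∀ i ≤ n, i • d ∈ J0 := by
    intro i hi
    cases i with
    | zero => simp [hzero]
    | succ i =>
      by_contra hi'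
      have := Nat.find_min' hex hi'
      change n ≤ i at this
      omega
  have hH : IsModuleSubgroup (J : Set G) (AddSubgroup.zmultiples d) := by
    have step : ∀ j ∈ J, j ∉ AddSubgroup.zmultiples d → d + j ∈ J := by
      intro j hj hjH
      have h1 : d + j ∈ J0 := by
        by_contra h1
        rw [exit_unique j (Finset.mem_insert_of_mem hj) h1 (n • d) (hle n le_rfl)
          (by rwa [← succ_nsmul'])] at hjH
        exact hjH (nsmul_mem (AddSubgroup.mem_zmultiples d) n)
      refine hmemJ _ h1 fun h0 => hjH ?_
      rw [eq_neg_of_add_eq_zero_right h0]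
      exact neg_mem (AddSubgroup.mem_zmultiples d)
    intro j hj hjH a ha
    obtain ⟨i, rfl⟩ := AddSubmonoid.mem_multiples_iff _ _ |>.1
      (mem_multiples_iff_mem_zmultiples.2 ha)
    clear ha
    induction i with
    | zero => simpa using hj
    | succ i ih =>
      have := step (j + i • d) ih fun hm => hjH
        ((AddSubgroup.add_mem_cancel_right _ (nsmul_mem (AddSubgroup.mem_zmultiples d) i)).1 hm)
      rw [succ_nsmul', ← add_assoc, add_comm j d, add_assoc]
      exact this
  rcases hp _ hH with hbot | htop
  · exact hd0 (AddSubgroup.zmultiples_eq_bot.1 hbot)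
  have hgen : ∀ x : G, ∃ i : ℕ, i • d = x := fun x =>
    AddSubmonoid.mem_multiples_iff _ _ |>.1 (mem_multiples_iff_mem_zmultiples.2
      (htop ▸ AddSubgroup.mem_top x))
  have hinit : ∀ x ∈ J0, ∃ i ≤ n, x = i • d := by
    intro x hx
    by_contra! hx'
    -- Stepping back by `d` from a point off the progression neither leaves J₀ nor lands on the
    -- progression, yet must reach 0.
    have desc : ∀ k : ℕ, x - k • d ∈ J0 ∧ ∀ i ≤ n, x - k • d ≠ i • d := by
      intro k
      induction k with
      | zero => simpa using ⟨hx, hx'⟩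
      | succ k ih =>
        have hs : x - (k + 1) • d = x - k • d - d := by rw [succ_nsmul]; abel
        have h1 := pred_mem _ ih.1 (by simpa using ih.2 0 (Nat.zero_le n))
        refine ⟨hs ▸ h1, fun i hi hi' => ?_⟩
        have h2 : x - k • d = (i + 1) • d := by
          rw [succ_nsmul, ← hi', hs]; abel
        rcases Nat.lt_or_ge i n with h3 | h3
        · exact ih.2 (i + 1) h3 h2
        · have : i = n := le_antisymm hi h3
          rw [this] at h2
          exact hn (h2 ▸ ih.1)
    obtain ⟨k, hk⟩ := hgen x
    exact (desc k).2 0 (Nat.zero_le n) (by simp [hk])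
  have hpos : ∀ i, 1 ≤ i → i ≤ n → i • d ∈ J := by
    intro i hi hin
    refine hmemJ _ (hle i hin) fun h0 => hnegd ?_
    have := hle (i - 1) (by omega)
    rwa [show (i - 1) • d = -d from eq_neg_of_add_eq_zero_left (by
      rw [← succ_nsmul, Nat.sub_add_cancel hi, h0])] at this
  have hn1 : 1 ≤ n := by
    by_contra! h1
    have : n = 0 := by omega
    rw [this] at hn
    exact hn (by rw [zero_add, one_nsmul]; exact Finset.mem_insert_of_mem hd)
  -- Otherwise stepping back would reach (n + 1)d ∉ J₀; it never meets 0, since a sum of two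
  -- elements of `J` is nonzero.
  have hout : ∀ i, 1 ≤ i → i ≤ n → (n + i) • d ∉ J0 := by
    intro i hi
    induction i, hi using Nat.le_induction with
    | base => exact fun _ => hn
    | succ i hi ih =>
      intro hin hmem
      refine ih (by omega) ?_
      have h1 : (n + (i + 1)) • d ≠ 0 := by
        rw [add_nsmul]
        exact hJ.add_ne_zero (hpos n hn1 le_rfl) (hpos (i + 1) (by omega) hin)
      have h2 := pred_mem _ hmem h1
      rwa [← add_assoc, succ_nsmul, add_sub_cancel_right] at h2
  have final : ∀ x ∈ J, n • d + x ∉ J := by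
    intro x hx hmem
    obtain ⟨i, hi, rfl⟩ := hinit x (Finset.mem_insert_of_mem hx)
    have hi1 : 1 ≤ i := by
      by_contra! h1
      have : i = 0 := by omega
      rw [this, zero_nsmul] at hx
      exact h0J hx
    rw [← add_nsmul] at hmem
    exact hout i hi1 hi (Finset.mem_insert_of_mem hmem)
  rcases h.mem_iff.1 (hpos n hn1 le_rfl) with hP | hQ
  · obtain ⟨q, hq⟩ := h.right_nonempty
    exact final q (h.mem_iff.2 (Or.inr hq)) (h.add_mem _ hP q hq)
  · obtain ⟨p, hp'⟩ := h.left_nonempty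
    exact final p (h.mem_iff.2 (Or.inl hp')) (h.symm.add_mem _ hQ p hp')

end IsSplit

end Fragments

end IsTournamentSet

/-! ### Rainbow-free colourings -/

namespace Digraph

/-- The Cayley digraph of an additive abelian group with connection set `J`. -/
def cayley {G : Type*} [AddCommGroup G] (J : Set G) : Digraph G where
  Adj x y := y - x ∈ J

/-- A vertex colouring in which no directed triangle has three different colours. -/
def IsRainbowFree {V α : Type*} (D : Digraph V) (f : V → α) : Prop :=
  ∀ u v w, D.Adj u v → D.Adj v w → D.Adj w u → f u = f v ∨ f v = f w ∨ f w = f u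

theorem IsRainbowFree.comp {V α β : Type*} {D : Digraph V} {f : V → α} (hf : D.IsRainbowFree f)
    (g : α → β) : D.IsRainbowFree (g ∘ f) := fun u v w h1 h2 h3 =>
  (hf u v w h1 h2 h3).imp (congrArg g) (Or.imp (congrArg g) (congrArg g))

end Digraph

open Digraph

/-- The sizes of the three classes of a 3-colouring add up to the number of vertices. -/
theorem card_add_card_add_card_of_three_coloring {V α : Type*} [Fintype V] [DecidableEq V]
    [DecidableEq α] {f : V → α} {a b c : α} (hab : a ≠ b) (hac : a ≠ c) (hbc : b ≠ c)
    (hall : ∀ x, f x = a ∨ f x = b ∨ f x = c) :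
    (Finset.univ.filter (f · = a)).card + (Finset.univ.filter (f · = b)).card +
      (Finset.univ.filter (f · = c)).card = Fintype.card V := by
  rw [← Finset.card_univ, ← Finset.card_union_of_disjoint, ← Finset.card_union_of_disjoint]
  · congr 1
    ext x
    simpa [or_assoc] using hall x
  · rw [Finset.disjoint_left]
    intro x
    simp only [Finset.mem_union, Finset.mem_filter, Finset.mem_univ, true_and]
    rintro (h | h) h' <;> simp_all
  · rw [Finset.disjoint_left]
    intro x
    simp only [Finset.mem_filter, Finset.mem_univ, true_and]
    intro h h'
    exact hab (h.symm.trans h')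

namespace IsTournamentSet

section Cayley

variable {G : Type*} [AddCommGroup G] {J : Set G}

theorem cayley_asymm (hJ : IsTournamentSet J) {x y : G} (h : (cayley J).Adj x y) :
    ¬ (cayley J).Adj y x := fun h' => hJ.neg_notMem _ h (by simpa [cayley] using h')

theorem cayley_total (hJ : IsTournamentSet J) {x y : G} (h : x ≠ y) :
    (cayley J).Adj x y ∨ (cayley J).Adj y x := by
  simpa [cayley] using hJ.mem_or_neg_mem (y - x) (sub_ne_zero.2 h.symm)

theorem cayley_ne (hJ : IsTournamentSet J) {x y : G} (h : (cayley J).Adj x y) : x ≠ y := by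
  rintro rfl
  exact hJ.zero_notMem (by simpa [cayley] using h)

theorem cayley_exists_triangle [Finite G] (hJ : IsTournamentSet J) {x y : G}
    (h : (cayley J).Adj x y) : ∃ z, (cayley J).Adj y z ∧ (cayley J).Adj z x := by
  obtain ⟨j, hj, hj'⟩ := hJ.exists_neg_add_mem h
  refine ⟨y + j, by simpa [cayley] using hj, ?_⟩
  rw [show -(y - x + j) = x - (y + j) by abel] at hj'
  exact hj'

end Cayley

/-! ### Three-colourings of prime Cayley tournaments -/

section Tight

variable {G : Type*} [AddCommGroup G] [Fintype G] [DecidableEq G] {J : Finset G}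
variable {α : Type*} [DecidableEq α] {f : G → α} {a b c : α}

theorem card_filter_adj (z : G) [DecidablePred fun x => (cayley (J : Set G)).Adj x z] :
    (Finset.univ.filter fun x => (cayley (J : Set G)).Adj x z).card = J.card := by
  have : (Finset.univ.filter fun x => (cayley (J : Set G)).Adj x z) = J.image (z - ·) := by
    ext x
    simp only [cayley, Finset.mem_filter, Finset.mem_univ, true_and, Finset.mem_image,
      Finset.mem_coe]
    exact ⟨fun h => ⟨_, h, by simp⟩, by rintro ⟨j, hj, rfl⟩; simpa using hj⟩
  rw [this, Finset.card_image_of_injective _ sub_right_injective]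

/-- If a colour class is dominated by vertices of both other colours, then it is a singleton. -/
theorem card_class_eq_one_of_dominated (hJ : IsTournamentSet (J : Set G))
    (hp : IsPrimeSet (J : Set G)) (hf : (cayley (J : Set G)).IsRainbowFree f) (hab : a ≠ b)
    (hac : a ≠ c) (hbc : b ≠ c) (hall : ∀ x, f x = a ∨ f x = b ∨ f x = c)
    (ha : ∃ x, f x = a ∧ ∀ z, f z = c → (cayley (J : Set G)).Adj x z)
    (hb : ∃ x, f x = b ∧ ∀ z, f z = c → (cayley (J : Set G)).Adj x z) (hc : ∃ z, f z = c) :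
    (Finset.univ.filter (f · = c)).card = 1 := by
  classical
  -- If y of colour `b` dominates colour `c` and x of colour `a` does not, some z of colour `c` has
  -- z → x, so x → y would close a rainbow triangle. Adding both versions of the bound gives |A| +
  -- |B| + 2|C| ≤ |G| + 1.
  have half : ∀ a b : α, a ≠ b → a ≠ c → b ≠ c →
      (∃ x, f x = b ∧ ∀ z, f z = c → (cayley (J : Set G)).Adj x z) →
      (Finset.univ.filter fun x =>
          f x = a ∧ ¬ ∀ z, f z = c → (cayley (J : Set G)).Adj x z).card +
        (Finset.univ.filter (f · = c)).card +
        (Finset.univ.filter fun x =>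
          f x = b ∧ ∀ z, f z = c → (cayley (J : Set G)).Adj x z).card ≤ J.card + 1 := by
    intro a b hab hac hbc hb
    rw [← Finset.card_union_of_disjoint]
    · refine hJ.card_add_card_le_of_dominates hp ?_ ?_ ?_
      · obtain ⟨z, hz⟩ := hc
        exact ⟨z, by simp [hz]⟩
      · obtain ⟨x, hx⟩ := hb
        exact ⟨x, by rw [Finset.mem_filter]; exact ⟨Finset.mem_univ _, hx⟩⟩
      · intro y hy x hx
        rw [Finset.mem_filter] at hy
        obtain ⟨-, hyb, hyc⟩ := hy
        rw [Finset.mem_union, Finset.mem_filter, Finset.mem_filter] at hx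
        rcases hx with ⟨-, hxa, hxc⟩ | ⟨-, hxc⟩
        · push Not at hxc
          obtain ⟨z, hzc, hxz⟩ := hxc
          have hzx := (hJ.cayley_total (x := x) (y := z)
            (by rintro rfl; exact hac (hxa.symm.trans hzc))).resolve_left hxz
          by_contra hyx
          have hxy := (hJ.cayley_total (x := y) (y := x)
            (by rintro rfl; exact hab (hxa.symm.trans hyb))).resolve_left hyx
          have := hf x y z hxy (hyc z hzc) hzx
          rw [hxa, hyb, hzc] at this
          rcases this with h | h | h
          · exact hab h
          · exact hbc h
          · exact hac h.symm
        · exact hyc x hxc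
    · rw [Finset.disjoint_left]
      intro x hx hx'
      simp only [Finset.mem_filter] at hx hx'
      exact hac (hx.2.1.symm.trans hx'.2)
  have h1 := half a b hab hac hbc hb
  have h2 := half b a hab.symm hbc hac ha
  have split : ∀ k : α, (Finset.univ.filter fun x =>
        f x = k ∧ ∀ z, f z = c → (cayley (J : Set G)).Adj x z).card +
      (Finset.univ.filter fun x =>
        f x = k ∧ ¬ ∀ z, f z = c → (cayley (J : Set G)).Adj x z).card =
      (Finset.univ.filter (f · = k)).card := by
    intro k
    rw [← Finset.filter_filter, ← Finset.filter_filter]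
    exact Finset.card_filter_add_card_filter_not _
  have h3 := split a
  have h4 := split b
  have h5 := card_add_card_add_card_of_three_coloring hab hac hbc hall
  have h6 := hJ.two_mul_card_add_one
  have h7 : 0 < (Finset.univ.filter (f · = c)).card := by
    obtain ⟨z, hz⟩ := hc
    exact Finset.card_pos.2 ⟨z, by simp [hz]⟩
  omega

/-- A vertex with the fewest in-neighbours of colour `a`, among the vertices of the other two
colours, dominates the vertices of colour `a`. -/
theorem dominates_of_min (hJ : IsTournamentSet (J : Set G))
    (hp : IsPrimeSet (J : Set G)) (hf : (cayley (J : Set G)).IsRainbowFree f) (hab : a ≠ b)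
    (hac : a ≠ c) (hbc : b ≠ c) (hall : ∀ x, f x = a ∨ f x = b ∨ f x = c)
    (hc : ∃ z, f z = c) (hc1 : (Finset.univ.filter (f · = c)).card ≠ 1) (F : G → Finset G)
    (hF : ∀ z x, x ∈ F z ↔ f x = a ∧ (cayley (J : Set G)).Adj x z) (z : G) (hz : f z = b)
    (hmin : ∀ w, f w ≠ a → (F z).card ≤ (F w).card) :
    ∀ x, f x = a → (cayley (J : Set G)).Adj z x := by
  classical
  set D := cayley (J : Set G) with hD
  by_contra! hcon
  obtain ⟨x0, hx0, hzx0⟩ := hcon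
  have hx0F : x0 ∈ F z := (hF z x0).2 ⟨hx0, (hJ.cayley_total
    (by rintro rfl; exact hab (hx0.symm.trans hz))).resolve_left hzx0⟩
  -- A vertex in `F u` but not in `F w` would form a rainbow triangle with the arc from `u` to `w`.
  have mono : ∀ k l : α, a ≠ k → a ≠ l → k ≠ l → ∀ u w, f u = k → f w = l → D.Adj u w →
      F u ⊆ F w := by
    intro k l hak hal hkl u w hu hw huw x hx
    obtain ⟨hxa, hxu⟩ := (hF u x).1 hx
    refine (hF w x).2 ⟨hxa, ?_⟩
    by_contra hxw
    have hwx := (hJ.cayley_total (x := x) (y := w)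
      (by rintro rfl; exact hal (hxa.symm.trans hw))).resolve_left hxw
    have := hf x u w hxu huw hwx
    rw [hxa, hu, hw] at this
    rcases this with h | h | h
    · exact hak h
    · exact hkl h
    · exact hal h.symm
  have hFc' : ∀ w, f w = c → D.Adj w z → F w = F z := fun w hw hwz =>
    Finset.eq_of_subset_of_card_le (mono c b hac hab hbc.symm w z hw hz hwz)
      (hmin w (by rw [hw]; exact hac.symm))
  have hFc : ∀ w, f w = c → F z ⊆ F w := by
    intro w hw
    rcases hJ.cayley_total (x := z) (y := w)
      (by rintro rfl; exact hbc (hz.symm.trans hw)) with h | h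
    · exact mono b c hab hac hbc z w hz hw h
    · rw [hFc' w hw h]
  have hFb : ∀ w, f w = b → F z ⊆ F w := by
    intro w hw
    by_cases hex : ∃ y, f y = c ∧ D.Adj y w
    · obtain ⟨y, hy, hyw⟩ := hex
      exact (hFc y hy).trans (mono c b hac hab hbc.symm y w hy hw hyw)
    · push Not at hex
      -- Here `w` and `x0` both dominate colour `c`, whose class would then be singular.
      refine absurd (hJ.card_class_eq_one_of_dominated hp hf hab hac hbc hall
        ⟨x0, hx0, fun y hy => ((hF y x0).1 (hFc y hy hx0F)).2⟩ ⟨w, hw, fun y hy => ?_⟩ hc) hc1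
      exact (hJ.cayley_total (by rintro rfl; exact hbc (hw.symm.trans hy))).resolve_right
        (hex y hy)
  have hFM : ∀ w, f w ≠ a → F z ⊆ F w := by
    intro w hw
    rcases hall w with h | h | h
    · exact absurd h hw
    · exact hFb w h
    · exact hFc w h
  have hdom : (Finset.univ.filter (f · ≠ a)).card + (F z).card ≤ J.card + 1 := by
    refine hJ.card_add_card_le_of_dominates hp ⟨z, by simp [hz, hab.symm]⟩ ⟨x0, hx0F⟩ ?_
    intro y hy x hx
    rw [Finset.mem_filter] at hx
    exact ((hF x y).1 (hFM x hx.2 hy)).2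
  -- `hdom` leaves no slack: the |J| in-neighbours of `u` must exhaust `F z` and all other vertices
  -- not of colour `a`. Two such `u` would dominate each other.
  have full : ∀ u, f u ≠ a → F u = F z → ∀ w, f w ≠ a → w ≠ u → D.Adj w u := by
    intro u hu hFu w hw hwu
    by_contra hadj
    have hin : (Finset.univ.filter fun x => D.Adj x u) ⊆
        F z ∪ ((Finset.univ.filter (f · ≠ a)).erase u).erase w := by
      intro x hx
      rw [Finset.mem_filter] at hx
      by_cases hxa : f x = a
      · exact Finset.mem_union_left _ (hFu ▸ (hF u x).2 ⟨hxa, hx.2⟩)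
      · refine Finset.mem_union_right _ (Finset.mem_erase.2 ⟨?_, Finset.mem_erase.2 ⟨?_, ?_⟩⟩)
        · rintro rfl; exact hadj hx.2
        · exact hJ.cayley_ne hx.2
        · simp [hxa]
    have h1 := (Finset.card_le_card hin).trans (Finset.card_union_le _ _)
    have hwm : w ∈ (Finset.univ.filter (f · ≠ a)).erase u := by simp [hw, hwu]
    have hum : u ∈ Finset.univ.filter (f · ≠ a) := by simp [hu]
    rw [card_filter_adj, Finset.card_erase_of_mem hwm, Finset.card_erase_of_mem hum] at h1
    have h2 := Finset.card_pos.2 ⟨w, hwm⟩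
    rw [Finset.card_erase_of_mem hum] at h2
    omega
  obtain ⟨w, hw⟩ := hc
  have hwa : f w ≠ a := by rw [hw]; exact hac.symm
  have hza : f z ≠ a := by rw [hz]; exact hab.symm
  have hwz : w ≠ z := by rintro rfl; exact hbc (hz.symm.trans hw)
  have h1 := full z hza rfl w hwa hwz
  exact hJ.cayley_asymm h1 (full w hwa (hFc' w hw h1) z hza hwz.symm)

theorem exists_dominating (hJ : IsTournamentSet (J : Set G))
    (hp : IsPrimeSet (J : Set G)) (hf : (cayley (J : Set G)).IsRainbowFree f) (hab : a ≠ b)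
    (hac : a ≠ c) (hbc : b ≠ c) (hall : ∀ x, f x = a ∨ f x = b ∨ f x = c)
    (hb : ∃ z, f z = b) (hc : ∃ z, f z = c)
    (hb1 : (Finset.univ.filter (f · = b)).card ≠ 1)
    (hc1 : (Finset.univ.filter (f · = c)).card ≠ 1) :
    ∃ z, f z ≠ a ∧ ∀ x, f x = a → (cayley (J : Set G)).Adj z x := by
  classical
  let F : G → Finset G := fun z =>
    Finset.univ.filter fun x => f x = a ∧ (cayley (J : Set G)).Adj x z
  have hF : ∀ z x, x ∈ F z ↔ f x = a ∧ (cayley (J : Set G)).Adj x z := fun z x => by simp [F]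
  obtain ⟨z, hz, hmin⟩ := (Finset.univ.filter (f · ≠ a)).exists_min_image (fun z => (F z).card)
    (by obtain ⟨z, hz⟩ := hb; exact ⟨z, by simp [hz, hab.symm]⟩)
  simp only [Finset.mem_filter, Finset.mem_univ, true_and] at hz hmin
  refine ⟨z, hz, ?_⟩
  rcases hall z with h | h | h
  · exact absurd h hz
  · exact hJ.dominates_of_min hp hf hab hac hbc hall hc hc1 F hF z h hmin
  · exact hJ.dominates_of_min hp hf hac hab hbc.symm
      (fun x => (hall x).imp_right Or.symm) hb hb1 F hF z h hmin

/-- In a prime Cayley tournament a partition into three classes without rainbow directed triangles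
has a singular class. -/
theorem exists_card_class_eq_one (hJ : IsTournamentSet (J : Set G))
    (hp : IsPrimeSet (J : Set G)) (hf : (cayley (J : Set G)).IsRainbowFree f) (hab : a ≠ b)
    (hac : a ≠ c) (hbc : b ≠ c) (hall : ∀ x, f x = a ∨ f x = b ∨ f x = c)
    (ha : ∃ z, f z = a) (hb : ∃ z, f z = b) (hc : ∃ z, f z = c) :
    (Finset.univ.filter (f · = a)).card = 1 ∨ (Finset.univ.filter (f · = b)).card = 1 ∨
      (Finset.univ.filter (f · = c)).card = 1 := by
  by_contra! hcon
  obtain ⟨ha1, hb1, hc1⟩ := hcon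
  -- Asymmetry determines the colours of the three dominating vertices, which then form a rainbow
  -- triangle.
  obtain ⟨x, hxa, hx⟩ := hJ.exists_dominating hp hf hab hac hbc hall hb hc hb1 hc1
  obtain ⟨y, hyb, hy⟩ := hJ.exists_dominating hp hf hab.symm hbc hac
    (fun x => by have := hall x; tauto) ha hc ha1 hc1
  obtain ⟨z, hzc, hz⟩ := hJ.exists_dominating hp hf hac.symm hbc.symm hab
    (fun x => by have := hall x; tauto) ha hb ha1 hb1
  have excl : ∀ u v, (cayley (J : Set G)).Adj u v → (cayley (J : Set G)).Adj v u → False :=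
    fun u v h h' => hJ.cayley_asymm h h'
  have hx' := (hall x).resolve_left hxa
  have hy' : f y = a ∨ f y = c := by have := hall y; tauto
  have hz' : f z = a ∨ f z = b := by have := hall z; tauto
  rcases hx' with hxb | hxc
  · have hyc : f y = c := hy'.resolve_left fun h => excl x y (hx y h) (hy x hxb)
    have hza : f z = a := hz'.resolve_right fun h => excl y z (hy z h) (hz y hyc)
    have := hf z y x (hz y hyc) (hy x hxb) (hx z hza)
    rw [hza, hyc, hxb] at this
    tauto
  · have hzb : f z = b := hz'.resolve_left fun h => excl x z (hx z h) (hz x hxc)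
    have hya : f y = a := hy'.resolve_right fun h => excl y z (hy z hzb) (hz y h)
    have := hf y z x (hy z hzb) (hz x hxc) (hx y hya)
    rw [hya, hzb, hxc] at this
    tauto

/-- A partition into three classes without rainbow directed triangles and with `{0}` as a class
splits the connection set. -/
theorem exists_isSplit (hJ : IsTournamentSet (J : Set G))
    (hf : (cayley (J : Set G)).IsRainbowFree f) (hab : a ≠ b)
    (hall : ∀ x, f x = a ∨ f x = b ∨ f x = c) (ha : ∃ z, f z = a) (hb : ∃ z, f z = b)
    (hac : a ≠ c) (hbc : b ≠ c) (hc : ∀ x, f x = c ↔ x = 0) : ∃ P Q : Finset G, IsSplit J P Q := by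
  have hne : ∀ i ∈ J, f i ≠ c ∧ f (-i) ≠ c := fun i hi => by
    have := hJ.ne_zero (x := i) hi
    simp [hc, this]
  have link : ∀ i ∈ J, ∀ j ∈ J, -(i + j) ∈ J → f i = f (-j) := by
    intro i hi j hj hk
    have h1 := hf 0 i (-j) (by simpa [cayley] using hi)
      (by simpa [cayley, sub_eq_add_neg, add_comm] using hk) (by simpa [cayley] using hj)
    rw [(hc 0).2 rfl] at h1
    rcases h1 with h | h | h
    · exact absurd h.symm (hne i hi).1
    · exact h
    · exact absurd h (hne j hj).2
  -- For a triangle with differences i, j, k, `link` gives f(-i) = f(j) = f(-k) = f(i).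
  have hsymm : ∀ i ∈ J, f (-i) = f i := by
    intro i hi
    obtain ⟨j, hj, hk⟩ := hJ.exists_neg_add_mem (i := i) hi
    have hj : j ∈ J := hj
    have hk : -(i + j) ∈ J := hk
    have h1 := link i hi _ hk (by rwa [show -(i + -(i + j)) = j by abel])
    have h2 := link j hj _ hk (by rwa [show -(j + -(i + j)) = i by abel])
    have h3 := link j hj i hi (by rwa [add_comm])
    rw [← h3, h2, ← h1]
  have attained : ∀ k : α, k ≠ c → (∃ z, f z = k) → ∃ i ∈ J, f i = k := by
    rintro k hk ⟨z, rfl⟩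
    rcases hJ.mem_or_neg_mem z (fun h => hk ((hc z).2 h)) with h | h
    · exact ⟨z, h, rfl⟩
    · exact ⟨-z, h, by rw [← hsymm _ h, neg_neg]⟩
  refine ⟨J.filter (f · = a), J.filter (f · = b), ?_, ?_, ?_, ?_, ?_⟩
  · ext x
    simp only [Finset.mem_union, Finset.mem_filter]
    constructor
    · rintro (h | h) <;> exact h.1
    · intro h
      have h1 := hall x
      have h2 := (hne x h).1
      tauto
  · rw [Finset.disjoint_left]
    intro x hx hx'
    rw [Finset.mem_filter] at hx hx'
    exact hab (hx.2.symm.trans hx'.2)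
  · obtain ⟨i, hi, h⟩ := attained a hac ha
    exact ⟨i, by simp [hi, h]⟩
  · obtain ⟨i, hi, h⟩ := attained b hbc hb
    exact ⟨i, by simp [hi, h]⟩
  · intro p hp q hq
    rw [Finset.mem_filter] at hp hq
    refine hJ.add_mem (x := p) (y := q) hp.1 hq.1 fun h => ?_
    have := link p hp.1 q hq.1 h
    rw [hsymm q hq.1, hp.2, hq.2] at this
    exact hab this

theorem not_isPrimeSet_of_rainbowFree (hJ : IsTournamentSet (J : Set G))
    (hf : (cayley (J : Set G)).IsRainbowFree f) (hab : a ≠ b)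
    (hac : a ≠ c) (hbc : b ≠ c) (hall : ∀ x, f x = a ∨ f x = b ∨ f x = c)
    (ha : ∃ z, f z = a) (hb : ∃ z, f z = b) (hc : ∃ z, f z = c) :
    ¬ IsPrimeSet (J : Set G) := by
  intro hp
  have main : ∀ a b c : α, a ≠ b → a ≠ c → b ≠ c → (∀ x, f x = a ∨ f x = b ∨ f x = c) →
      (∃ z, f z = a) → (∃ z, f z = b) → (Finset.univ.filter (f · = c)).card ≠ 1 := by
    intro a b c hab hac hbc hall ha hb h1
    obtain ⟨v, hv⟩ := Finset.card_eq_one.1 h1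
    have hv' : ∀ x, f x = c ↔ x = v := fun x => by
      simpa using Finset.ext_iff.1 hv x
    have hg : (cayley (J : Set G)).IsRainbowFree fun x => f (x + v) := by
      intro x y z h1 h2 h3
      exact hf (x + v) (y + v) (z + v) (by simpa [cayley] using h1) (by simpa [cayley] using h2)
        (by simpa [cayley] using h3)
    obtain ⟨P, Q, hPQ⟩ := hJ.exists_isSplit hg hab (fun x => hall (x + v))
      (by obtain ⟨z, hz⟩ := ha; exact ⟨z - v, by simpa using hz⟩)
      (by obtain ⟨z, hz⟩ := hb; exact ⟨z - v, by simpa using hz⟩) hac hbc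
      (fun x => by simp [hv'])
    exact hPQ.not_isPrimeSet hJ hp
  rcases hJ.exists_card_class_eq_one hp hf hab hac hbc hall ha hb hc with h | h | h
  · exact main b c a hbc hab.symm hac.symm (fun x => by have := hall x; tauto) hb hc h
  · exact main a c b hac hab hbc.symm (fun x => by have := hall x; tauto) ha hc h
  · exact main a b c hab hac hbc hall ha hb h

end Tight

/-- Colourings of a prime Cayley tournament without rainbow directed triangles use at most two
colours. -/
theorem ncard_range_le_two {G : Type*} [AddCommGroup G] [Finite G] {J : Set G}
    (hJ : IsTournamentSet J) (hp : IsPrimeSet J) {α : Type*} {f : G → α}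
    (hf : (cayley J).IsRainbowFree f) : (Set.range f).ncard ≤ 2 := by
  classical
  have := Fintype.ofFinite G
  by_contra! h
  obtain ⟨_, ⟨x, rfl⟩, _, ⟨y, rfl⟩, _, ⟨z, rfl⟩, hxy, hxz, hyz⟩ := (Set.two_lt_ncard (Set.toFinite _)).1 h
  -- Merging colours creates no rainbow triangle, so exactly three colours may be assumed.
  let g : α → α := fun k => if k = f x then f x else if k = f y then f y else f z
  have hJ' : IsTournamentSet (J.toFinset : Set G) := by rwa [Set.coe_toFinset]
  refine hJ'.not_isPrimeSet_of_rainbowFree (f := g ∘ f) (a := f x) (b := f y) (c := f z) ?_ hxy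
    hxz hyz ?_ ⟨x, ?_⟩ ⟨y, ?_⟩ ⟨z, ?_⟩ ?_
  · rw [Set.coe_toFinset]
    exact hf.comp g
  · intro u
    simp only [Function.comp, g]
    split_ifs <;> simp
  · simp [g]
  · simp [g, hxy.symm]
  · simp [g, hxz.symm, hyz.symm]
  · rwa [Set.coe_toFinset]

end IsTournamentSet

universe u

/-! ### Optimal colourings of triangular tournaments -/

namespace Digraph

/-- A tournament in which every arc lies in a directed triangle. -/
structure IsTriangularTournament {V : Type*} (D : Digraph V) : Prop where
  asymm : ∀ x y, D.Adj x y → ¬ D.Adj y x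
  total : ∀ x y, x ≠ y → D.Adj x y ∨ D.Adj y x
  exists_triangle : ∀ x y, D.Adj x y → ∃ z, D.Adj y z ∧ D.Adj z x

theorem IsTriangularTournament.ne {V : Type*} {D : Digraph V} (hD : D.IsTriangularTournament)
    {x y : V} (h : D.Adj x y) : x ≠ y := by
  rintro rfl
  exact hD.asymm _ _ h h

theorem IsTriangularTournament.of_iso {V W : Type*} {D : Digraph V} {F : Digraph W}
    (hD : D.IsTriangularTournament) (e : F.Adj ≃r D.Adj) : F.IsTriangularTournament where
  asymm x y h h' := hD.asymm _ _ (e.map_rel_iff.2 h) (e.map_rel_iff.2 h')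
  total x y h := (hD.total (e x) (e y) (e.injective.ne h)).imp e.map_rel_iff.1 e.map_rel_iff.1
  exists_triangle x y h := by
    obtain ⟨z, h1, h2⟩ := hD.exists_triangle _ _ (e.map_rel_iff.2 h)
    refine ⟨e.symm z, e.map_rel_iff.1 ?_, e.map_rel_iff.1 ?_⟩
    · rwa [e.apply_symm_apply]
    · rwa [e.apply_symm_apply]

/-- The maximum number of colours in a colouring without rainbow directed triangles is `k`, and it
is attained by a colouring with a colour used exactly once. -/
structure HasSingularOptimum {V : Type*} (D : Digraph V) (k : ℕ) : Prop where
  exists_coloring : ∃ f : V → ℕ, D.IsRainbowFree f ∧ (Set.range f).ncard = k ∧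
    ∃ v, ∀ u, f u = f v → u = v
  ncard_le : ∀ f : V → ℕ, D.IsRainbowFree f → (Set.range f).ncard ≤ k

theorem HasSingularOptimum.ncard_range_le {V α : Type*} [Finite V] {D : Digraph V} {k : ℕ}
    (h : D.HasSingularOptimum k) {f : V → α} (hf : D.IsRainbowFree f) :
    (Set.range f).ncard ≤ k := by
  obtain ⟨n, ⟨e⟩⟩ := Finite.exists_equiv_fin (Set.range f)
  have hg : D.IsRainbowFree fun x => (e ⟨f x, x, rfl⟩ : ℕ) := by
    have key : ∀ x y, f x = f y → (e ⟨f x, x, rfl⟩ : ℕ) = e ⟨f y, y, rfl⟩ := fun x y h =>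
      congrArg (fun a => (e a : ℕ)) (Subtype.ext h)
    exact fun x y z h1 h2 h3 => (hf x y z h1 h2 h3).imp (key _ _) (Or.imp (key _ _) (key _ _))
  refine le_trans (le_of_eq ?_) (h.ncard_le _ hg)
  refine Set.ncard_congr (fun a ha => (e ⟨a, ha⟩ : ℕ)) ?_ ?_ ?_
  · rintro _ ⟨x, rfl⟩
    exact ⟨x, rfl⟩
  · intro a b ha hb hab
    simpa [Fin.val_inj] using hab
  · rintro _ ⟨x, rfl⟩
    exact ⟨f x, ⟨x, rfl⟩, rfl⟩

theorem HasSingularOptimum.of_iso {V W : Type*} {D : Digraph V} {F : Digraph W} {k : ℕ}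
    (hD : D.HasSingularOptimum k) (e : F.Adj ≃r D.Adj) : F.HasSingularOptimum k where
  exists_coloring := by
    obtain ⟨f, hf, hk, v, hv⟩ := hD.exists_coloring
    refine ⟨f ∘ e, fun x y z h1 h2 h3 => hf _ _ _ (e.map_rel_iff.2 h1) (e.map_rel_iff.2 h2)
      (e.map_rel_iff.2 h3), ?_, e.symm v, fun u hu => ?_⟩
    · rwa [e.surjective.range_comp]
    · rw [Function.comp, Function.comp, e.apply_symm_apply] at hu
      rw [← hv _ hu, e.symm_apply_apply]
  ncard_le f hf := by
    have hg : D.IsRainbowFree (f ∘ e.symm) := fun x y z h1 h2 h3 =>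
      hf _ _ _ (e.symm.map_rel_iff.2 h1) (e.symm.map_rel_iff.2 h2) (e.symm.map_rel_iff.2 h3)
    have := hD.ncard_le _ hg
    rwa [e.symm.surjective.range_comp] at this

theorem isRainbowFree_of_ncard_le_two {V α : Type*} [Finite V] (D : Digraph V) {f : V → α}
    (h : (Set.range f).ncard ≤ 2) : D.IsRainbowFree f := by
  intro x y z _ _ _
  by_contra! hcon
  obtain ⟨h1, h2, h3⟩ := hcon
  have := (Set.two_lt_ncard (Set.toFinite (Set.range f))).2
    ⟨f x, ⟨x, rfl⟩, f y, ⟨y, rfl⟩, f z, ⟨z, rfl⟩, h1, h3.symm, h2⟩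
  omega

/-- A colouring of a nontrivial vertex set with two colours, one of them used exactly once. -/
theorem exists_coloring_ncard_eq_two (V : Type*) [Nontrivial V] :
    ∃ f : V → ℕ, (Set.range f).ncard = 2 ∧ ∃ v, ∀ u, f u = f v → u = v := by
  classical
  obtain ⟨v, w, hvw⟩ := exists_pair_ne V
  refine ⟨fun u => if u = v then 0 else 1, ?_, v, fun u hu => ?_⟩
  · rw [show Set.range (fun u => if u = v then 0 else 1) = ({0, 1} : Set ℕ) from ?_]
    · exact Set.ncard_pair zero_ne_one
    · ext n
      simp only [Set.mem_range, Set.mem_insert_iff, Set.mem_singleton_iff]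
      constructor
      · rintro ⟨u, rfl⟩
        split_ifs <;> simp
      · rintro (rfl | rfl)
        · exact ⟨v, by simp⟩
        · exact ⟨w, by simp [hvw.symm]⟩
  · by_contra h
    simp [h] at hu

theorem HasSingularOptimum.two_le {V : Type*} [Finite V] [Nontrivial V] {D : Digraph V} {k : ℕ}
    (hD : D.HasSingularOptimum k) : 2 ≤ k := by
  obtain ⟨f, hf, -⟩ := exists_coloring_ncard_eq_two V
  exact hf ▸ hD.ncard_le f (D.isRainbowFree_of_ncard_le_two hf.le)

/-! ### Optimal colourings of compositions -/

section Compose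

variable {V W : Type*} {D : Digraph V} {F : Digraph W}

/-- A directed triangle of a composition lies in a copy of the second factor or projects to a
directed triangle of the first factor. -/
theorem compose_triangle (hD : D.IsTriangularTournament) {x y z : V × W}
    (h1 : (D.compose F).Adj x y) (h2 : (D.compose F).Adj y z) (h3 : (D.compose F).Adj z x) :
    (x.1 = y.1 ∧ y.1 = z.1 ∧ F.Adj x.2 y.2 ∧ F.Adj y.2 z.2 ∧ F.Adj z.2 x.2) ∨
      (D.Adj x.1 y.1 ∧ D.Adj y.1 z.1 ∧ D.Adj z.1 x.1) := by
  have irr : ∀ v, ¬ D.Adj v v := fun v h => hD.asymm v v h h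
  have asymm := hD.asymm
  obtain ⟨x1, x2⟩ := x
  obtain ⟨y1, y2⟩ := y
  obtain ⟨z1, z2⟩ := z
  simp only [compose] at h1 h2 h3 ⊢
  rcases h1 with ⟨rfl, h1⟩ | h1 <;> rcases h2 with ⟨rfl, h2⟩ | h2 <;>
    rcases h3 with ⟨h, h3⟩ | h3 <;> grind

/-- Colouring one copy of the second factor of a composition separately. -/
theorem compose_exists_coloring [Finite V] [Finite W] (hD : D.IsTriangularTournament) {k l : ℕ}
    (hDk : D.HasSingularOptimum k) (hFl : F.HasSingularOptimum l) :
    ∃ f : V × W → ℕ, (D.compose F).IsRainbowFree f ∧ (Set.range f).ncard = k + l - 1 ∧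
      ∃ v, ∀ u, f u = f v → u = v := by
  classical
  obtain ⟨f, hf, hfk, v, hv⟩ := hDk.exists_coloring
  obtain ⟨g, hg, hgl, w, hw⟩ := hFl.exists_coloring
  -- The copy at the singular vertex receives l even colours; the other copies keep their k - 1
  -- colours, made odd.
  refine ⟨fun x => if x.1 = v then 2 * g x.2 else 2 * f x.1 + 1, ?_, ?_, (v, w), ?_⟩
  · intro x y z h1 h2 h3
    rcases compose_triangle hD h1 h2 h3 with ⟨e1, e2, h1, h2, h3⟩ | ⟨h1, h2, h3⟩
    · by_cases hx : x.1 = v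
      · have := hg _ _ _ h1 h2 h3
        simp only [← e2, ← e1, hx, if_true]
        omega
      · left
        simp only [← e1, hx, if_false]
    · have key : ∀ a b : V × W, D.Adj a.1 b.1 → f a.1 = f b.1 →
          (if a.1 = v then 2 * g a.2 else 2 * f a.1 + 1) =
            if b.1 = v then 2 * g b.2 else 2 * f b.1 + 1 := by
        intro a b hab he
        have ha : a.1 ≠ v := fun ha => hD.ne hab (by rw [hv b.1 (by rw [← he, ha]), ha])
        have hb : b.1 ≠ v := fun hb => hD.ne hab (by rw [hv a.1 (by rw [he, hb]), hb])
        rw [if_neg ha, if_neg hb, he]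
      exact (hf _ _ _ h1 h2 h3).imp (key _ _ h1) (Or.imp (key _ _ h2) (key _ _ h3))
  · have hr : Set.range (fun x : V × W => if x.1 = v then 2 * g x.2 else 2 * f x.1 + 1) =
        (2 * ·) '' Set.range g ∪ (2 * · + 1) '' (Set.range f \ {f v}) := by
      ext n
      constructor
      · rintro ⟨x, rfl⟩
        by_cases hx : x.1 = v
        · left
          exact ⟨g x.2, ⟨_, rfl⟩, by simp [hx]⟩
        · right
          exact ⟨f x.1, ⟨⟨_, rfl⟩, fun h => hx (hv _ h)⟩, by simp [hx]⟩
      · rintro (⟨_, ⟨y, rfl⟩, rfl⟩ | ⟨_, ⟨⟨u, rfl⟩, hu⟩, rfl⟩)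
        · exact ⟨(v, y), by simp⟩
        · have : u ≠ v := by rintro rfl; exact hu rfl
          exact ⟨(u, w), by simp [this]⟩
    have hdisj : Disjoint ((2 * ·) '' Set.range g) ((2 * · + 1) '' (Set.range f \ {f v})) := by
      rw [Set.disjoint_left]
      rintro _ ⟨a, -, rfl⟩ ⟨b, -, h⟩
      simp only at h
      omega
    rw [hr, Set.ncard_union_eq hdisj (Set.toFinite _) (Set.toFinite _),
      Set.ncard_image_of_injective _ (fun a b (h : 2 * a = 2 * b) => by omega),
      Set.ncard_image_of_injective _ (fun a b (h : 2 * a + 1 = 2 * b + 1) => by omega), hgl,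
      Set.ncard_sdiff_singleton_of_mem (Set.mem_range_self v), hfk]
    have : 0 < k := by
      rw [← hfk]
      exact (Set.ncard_pos (Set.toFinite _)).2 ⟨_, v, rfl⟩
    omega
  · rintro ⟨a, b⟩ hab
    by_cases ha : a = v
    · simp only [ha, if_true] at hab
      rw [ha, hw b (by omega)]
    · simp only [ha, if_false, if_true] at hab
      omega

theorem compose_ncard_le [Finite V] [Finite W] [Nontrivial W] (hD : D.IsTriangularTournament)
    {k l : ℕ} (hDk : D.HasSingularOptimum k) (hFl : F.HasSingularOptimum l) (f : V × W → ℕ)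
    (hf : (D.compose F).IsRainbowFree f) : (Set.range f).ncard ≤ k + l - 1 := by
  classical
  have hl := hFl.two_le
  obtain ⟨w0⟩ : Nonempty W := inferInstance
  have tri : ∀ x y z, D.Adj x y → D.Adj y z → D.Adj z x → ∀ p q r,
      f (x, p) = f (y, q) ∨ f (y, q) = f (z, r) ∨ f (z, r) = f (x, p) :=
    fun x y z h1 h2 h3 p q r => hf _ _ _ (Or.inr h1) (Or.inr h2) (Or.inr h3)
  have sel : ∀ s : V → W, D.IsRainbowFree fun v => f (v, s v) :=
    fun s x y z h1 h2 h3 => tri x y z h1 h2 h3 _ _ _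
  have hfib : ∀ v, (Set.range fun w => f (v, w)).ncard ≤ l := fun v =>
    hFl.ncard_le _ fun x y z h1 h2 h3 => hf (v, x) (v, y) (v, z) (Or.inl ⟨rfl, h1⟩)
      (Or.inl ⟨rfl, h2⟩) (Or.inl ⟨rfl, h3⟩)
  by_cases h3 : ∃ v, 2 < (Set.range fun w => f (v, w)).ncard
  · obtain ⟨v, hv⟩ := h3
    -- With three colours in the copy at `v`, one of them avoids any two given colours.
    have opp : ∀ y z, D.Adj v y → D.Adj y z → D.Adj z v → ∀ q r, f (y, q) = f (z, r) := by
      intro y z h1 h2 h3 q r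
      by_contra hne
      obtain ⟨_, ⟨p, rfl⟩, hp⟩ := Set.exists_mem_notMem_of_ncard_lt_ncard
        (s := {f (y, q), f (z, r)}) (t := Set.range fun w => f (v, w))
        (lt_of_le_of_lt ((Set.ncard_insert_le _ _).trans (by rw [Set.ncard_singleton])) hv)
      simp only [Set.mem_insert_iff, Set.mem_singleton_iff, not_or] at hp
      rcases tri v y z h1 h2 h3 p q r with h | h | h
      · exact hp.1 h
      · exact hne h
      · exact hp.2 h.symm
    have const : ∀ y, y ≠ v → ∀ q, f (y, q) = f (y, w0) := by
      intro y hy q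
      rcases hD.total v y hy.symm with h | h
      · obtain ⟨z, h1, h2⟩ := hD.exists_triangle _ _ h
        rw [opp y z h h1 h2 q w0, ← opp y z h h1 h2 w0 w0]
      · obtain ⟨z, h1, h2⟩ := hD.exists_triangle _ _ h
        rw [← opp z y h1 h2 h w0 q, opp z y h1 h2 h w0 w0]
    -- All other copies are monochromatic. A fresh colour at `v` keeps `D` rainbow-free, so they use
    -- at most k - 1 colours.
    let g : V → ℕ := fun y => if y = v then 0 else f (y, w0) + 1
    have hg : D.IsRainbowFree g := by
      have eq_of : ∀ y z, D.Adj v y → D.Adj y z → D.Adj z v → g y = g z := by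
        intro y z h1 h2 h3
        simp only [g, (hD.ne h1).symm, hD.ne h3, if_false, opp y z h1 h2 h3 w0 w0]
      intro x y z h1 h2 h3
      by_cases hx : x = v
      · subst hx
        exact Or.inr (Or.inl (eq_of y z h1 h2 h3))
      by_cases hy : y = v
      · subst hy
        exact Or.inr (Or.inr (eq_of z x h2 h3 h1))
      by_cases hz : z = v
      · subst hz
        exact Or.inl (eq_of x y h3 h1 h2)
      have := tri x y z h1 h2 h3 w0 w0 w0
      simp only [g, hx, hy, hz, if_false]
      omega
    let S : Set ℕ := (fun y => f (y, w0)) '' {v}ᶜ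
    have hgS : Set.range g = insert 0 (Nat.succ '' S) := by
      ext n
      constructor
      · rintro ⟨y, rfl⟩
        by_cases hy : y = v
        · left; simp [g, hy]
        · right
          exact ⟨_, ⟨y, hy, rfl⟩, by simp [g, hy]⟩
      · rintro (rfl | ⟨_, ⟨y, hy, rfl⟩, rfl⟩)
        · exact ⟨v, by simp [g]⟩
        · have hy : y ≠ v := hy
          exact ⟨y, by simp [g, hy]⟩
    have hSk : S.ncard + 1 ≤ k := by
      have h1 := hDk.ncard_le g hg
      rwa [hgS, Set.ncard_insert_of_notMem (by simp) (Set.toFinite _),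
        Set.ncard_image_of_injective _ Nat.succ_injective] at h1
    have hsub : Set.range f ⊆ (Set.range fun w => f (v, w)) ∪ S := by
      rintro _ ⟨⟨y, q⟩, rfl⟩
      by_cases hy : y = v
      · left; exact ⟨q, by rw [hy]⟩
      · right; exact ⟨y, hy, (const y hy q).symm⟩
    have h1 := (Set.ncard_le_ncard hsub (Set.toFinite _)).trans (Set.ncard_union_le _ _)
    have h2 := hfib v
    omega
  · push Not at h3
    by_cases h2 : ∃ v p q, f (v, p) ≠ f (v, q)
    · obtain ⟨v, p1, p2, hp⟩ := h2
      let s : V → W := fun w => if w = v then p1 else w0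
      -- One vertex per copy sees all colours except perhaps one: at most k + 1 ≤ k + l - 1, since l
      -- ≥ 2.
      have hsub : Set.range f ⊆ insert (f (v, p2)) (Set.range fun w => f (w, s w)) := by
        rintro _ ⟨⟨w, q⟩, rfl⟩
        have hmem : f (w, q) = f (v, p2) ∨ f (w, q) = f (v, p1) ∨ w ≠ v ∧ f (w, q) = f (w, w0) := by
          by_cases hw : w = v
          · subst hw
            by_contra! hcon
            have := (Set.two_lt_ncard (Set.toFinite (Set.range fun r => f (w, r)))).2
              ⟨_, ⟨p1, rfl⟩, _, ⟨p2, rfl⟩, _, ⟨q, rfl⟩, hp, hcon.2.1.symm, hcon.1.symm⟩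
            exact absurd this (not_lt.2 (h3 w))
          · by_contra! hcon
            obtain ⟨hc1, hc2, hc3⟩ := hcon
            have hc3 := hc3 hw
            -- The two colours at `v` force `(x, w0)` to share the colour of `(w, q)`, and then `(w,
            -- w0)` to share it too.
            obtain ⟨x, hx⟩ : ∃ x, ∀ p q r, f (v, p) = f (w, q) ∨ f (w, q) = f (x, r) ∨
                f (x, r) = f (v, p) := by
              rcases hD.total v w (Ne.symm hw) with h | h
              · obtain ⟨x, h1, h2⟩ := hD.exists_triangle _ _ h
                exact ⟨x, tri v w x h h1 h2⟩
              · obtain ⟨x, h1, h2⟩ := hD.exists_triangle _ _ h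
                refine ⟨x, fun p q r => ?_⟩
                have := tri w v x h h1 h2 q p r
                tauto
            have e1 := hx p1 q w0
            have e2 := hx p2 q w0
            have e3 := hx p1 w0 w0
            have e4 := hx p2 w0 w0
            omega
        rcases hmem with h | h | ⟨hw, h⟩
        · exact Or.inl h
        · exact Or.inr ⟨v, by simp [s, h]⟩
        · exact Or.inr ⟨w, by simp [s, hw, h]⟩
      have h4 := (Set.ncard_le_ncard hsub (Set.toFinite _)).trans (Set.ncard_insert_le _ _)
      have h5 := hDk.ncard_le _ (sel s)
      omega
    · push Not at h2
      have hsub : Set.range f ⊆ Set.range fun w => f (w, w0) := by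
        rintro _ ⟨⟨w, q⟩, rfl⟩
        exact ⟨w, h2 w w0 q⟩
      have h4 := Set.ncard_le_ncard hsub (Set.toFinite _)
      have h5 := hDk.ncard_le _ (sel fun _ => w0)
      omega

theorem HasSingularOptimum.compose [Finite V] [Finite W] [Nontrivial W]
    (hD : D.IsTriangularTournament) {k l : ℕ} (hDk : D.HasSingularOptimum k)
    (hFl : F.HasSingularOptimum l) : (D.compose F).HasSingularOptimum (k + l - 1) :=
  ⟨compose_exists_coloring hD hDk hFl, compose_ncard_le hD hDk hFl⟩

end Compose

end Digraph

/-! ### Blocks, quotients and induction on the order of the group -/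

namespace IsTournamentSet

theorem isTriangularTournament {G : Type*} [AddCommGroup G] [Finite G] {J : Set G}
    (hJ : IsTournamentSet J) : (cayley J).IsTriangularTournament :=
  ⟨fun _ _ => hJ.cayley_asymm, fun _ _ => hJ.cayley_total, fun _ _ => hJ.cayley_exists_triangle⟩

section Quotient

variable {G : Type*} [AddCommGroup G] {J : Set G} {H : AddSubgroup G}

theorem comap_subtype (hJ : IsTournamentSet J) (H : AddSubgroup G) :
    IsTournamentSet {h : H | (h : G) ∈ J} where
  zero_notMem := hJ.zero_notMem
  neg_notMem j hj := hJ.neg_notMem j hj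
  mem_or_neg_mem x hx := hJ.mem_or_neg_mem x (by simpa using hx)

/-- The arcs of a Cayley tournament between different cosets of a block are the arcs of a
Cayley digraph on the quotient. -/
theorem mk_mem_iff (hH : IsModuleSubgroup J H) {x : G} (hx : x ∉ H) :
    (∃ j ∈ J, j ∉ H ∧ (j : G ⧸ H) = x) ↔ x ∈ J := by
  refine ⟨?_, fun h => ⟨x, h, hx, rfl⟩⟩
  rintro ⟨j, hj, hjH, hjx⟩
  have := hH j hj hjH _ (QuotientAddGroup.eq.1 hjx)
  simpa using this

theorem map_mk (hJ : IsTournamentSet J) (hH : IsModuleSubgroup J H) :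
    IsTournamentSet {q : G ⧸ H | ∃ j ∈ J, j ∉ H ∧ (j : G ⧸ H) = q} where
  zero_notMem := by
    rintro ⟨j, -, hjH, hj⟩
    exact hjH ((QuotientAddGroup.eq_zero_iff j).1 hj)
  neg_notMem := by
    rintro _ ⟨j, hj, hjH, rfl⟩ hneg
    rw [← QuotientAddGroup.mk_neg] at hneg
    exact hJ.neg_notMem j hj ((mk_mem_iff hH (by simpa using hjH)).1 hneg)
  mem_or_neg_mem q := by
    induction q using QuotientAddGroup.induction_on with
    | H x =>
      intro hx
      have hxH : x ∉ H := fun h => hx ((QuotientAddGroup.eq_zero_iff x).2 h)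
      rw [← QuotientAddGroup.mk_neg, Set.mem_ofPred_eq, Set.mem_ofPred_eq, mk_mem_iff hH hxH,
        mk_mem_iff hH (by simpa using hxH)]
      exact hJ.mem_or_neg_mem x fun h0 => hxH (h0 ▸ H.zero_mem)

/-- A Cayley tournament with a block is a composition. -/
theorem nonempty_iso_compose (hH : IsModuleSubgroup J H) :
    Nonempty ((cayley J).Adj ≃r
      ((cayley {q : G ⧸ H | ∃ j ∈ J, j ∉ H ∧ (j : G ⧸ H) = q}).compose
        (cayley {h : H | (h : G) ∈ J})).Adj) := by
  have hmem : ∀ x : G, -(x : G ⧸ H).out + x ∈ H := fun x =>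
    QuotientAddGroup.eq.1 (Quotient.out_eq' _)
  -- Coset and offset from its chosen representative; differences within a coset are preserved.
  let e : G ≃ (G ⧸ H) × H :=
    { toFun := fun x => ((x : G ⧸ H), ⟨-(x : G ⧸ H).out + x, hmem x⟩)
      invFun := fun p => p.1.out + p.2
      left_inv := fun x => by simp
      right_inv := by
        rintro ⟨q, h⟩
        have hq : ((q.out + (h : G) : G) : G ⧸ H) = q := by
          rw [QuotientAddGroup.mk_add_of_mem _ h.2]
          exact Quotient.out_eq' q
        ext
        · exact hq
        · simp [hq] }
  refine ⟨⟨e, ?_⟩⟩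
  intro x y
  change ((x : G ⧸ H) = y ∧ (-(y : G ⧸ H).out + y) - (-(x : G ⧸ H).out + x) ∈ J) ∨
    (y : G ⧸ H) - x ∈ {q : G ⧸ H | ∃ j ∈ J, j ∉ H ∧ (j : G ⧸ H) = q} ↔ y - x ∈ J
  rw [← QuotientAddGroup.mk_sub, Set.mem_ofPred_eq]
  by_cases hxy : y - x ∈ H
  · have hq : (x : G ⧸ H) = y := by
      rw [QuotientAddGroup.eq]
      simpa [sub_eq_neg_add] using hxy
    simp [hq]
  · have hq : (x : G ⧸ H) ≠ y := by
      intro h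
      rw [QuotientAddGroup.eq] at h
      exact hxy (by simpa [sub_eq_neg_add] using h)
    simp only [hq, false_and, false_or]
    exact mk_mem_iff hH hxy

end Quotient

/-- Cayley tournaments of finite abelian groups have optimal partitions with a singular class. -/
theorem exists_hasSingularOptimum (n : ℕ) : ∀ (G : Type u) [AddCommGroup G] [Finite G]
    [Nontrivial G] (J : Set G), IsTournamentSet J → Nat.card G = n →
      ∃ k, (cayley J).HasSingularOptimum k := by
  induction n using Nat.strong_induction_on with
  | _ n ih =>
    intro G _ _ _ J hJ hn
    by_cases hp : IsPrimeSet J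
    · obtain ⟨f, hf, hv⟩ := exists_coloring_ncard_eq_two G
      exact ⟨2, ⟨f, isRainbowFree_of_ncard_le_two _ hf.le, hf, hv⟩,
        fun g hg => hJ.ncard_range_le_two hp hg⟩
    · unfold IsPrimeSet at hp
      push Not at hp
      obtain ⟨H, hH, hbot, htop⟩ := hp
      have h1 : Nontrivial H := (AddSubgroup.nontrivial_iff_ne_bot H).2 hbot
      have h2 : Nontrivial (G ⧸ H) := by
        rw [← not_subsingleton_iff_nontrivial]
        exact fun h => htop (QuotientAddGroup.subsingleton_iff.1 h)
      have hmul := AddSubgroup.card_eq_card_quotient_mul_card_addSubgroup H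
      have hH1 : 1 < Nat.card H := Finite.one_lt_card
      have hQ1 : 1 < Nat.card (G ⧸ H) := Finite.one_lt_card
      obtain ⟨l, hl⟩ := ih (Nat.card H) (by rw [← hn, hmul]; nlinarith) H _
        (hJ.comap_subtype H) rfl
      obtain ⟨k, hk⟩ := ih (Nat.card (G ⧸ H)) (by rw [← hn, hmul]; nlinarith) (G ⧸ H) _
        (hJ.map_mk hH) rfl
      obtain ⟨e⟩ := nonempty_iso_compose (J := J) hH
      exact ⟨_, (hk.compose (hJ.map_mk hH).isTriangularTournament hl).of_iso e⟩

theorem prod {G₁ G₂ : Type*} [AddCommGroup G₁] [AddCommGroup G₂] {J₁ : Set G₁} {J₂ : Set G₂}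
    (h₁ : IsTournamentSet J₁) (h₂ : IsTournamentSet J₂) :
    IsTournamentSet {x : G₁ × G₂ | (x.1 = 0 ∧ x.2 ∈ J₂) ∨ x.1 ∈ J₁} where
  zero_notMem := by simp [h₁.zero_notMem, h₂.zero_notMem]
  neg_notMem := by
    rintro ⟨x, y⟩ (⟨hx, hy⟩ | hx)
    · have hx : x = 0 := hx
      simp [hx, h₁.zero_notMem, h₂.neg_notMem y hy]
    · simp [h₁.ne_zero hx, h₁.neg_notMem x hx]
  mem_or_neg_mem := by
    rintro ⟨x, y⟩ hxy
    by_cases hx : x = 0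
    · have hy : y ≠ 0 := fun hy => hxy (by rw [hx, hy]; rfl)
      rcases h₂.mem_or_neg_mem y hy with h | h
      · exact Or.inl (Or.inl ⟨hx, h⟩)
      · exact Or.inr (Or.inl ⟨by simp [hx], h⟩)
    · exact (h₁.mem_or_neg_mem x hx).imp Or.inr Or.inr

end IsTournamentSet

/-! ### From circulant compositions to abelian Cayley tournaments -/

namespace Digraph

theorem IsSymbolSet.isTournamentSet {m : ℕ} {J : Finset (ZMod (2 * m + 1))}
    (hJ : IsSymbolSet m J) : IsTournamentSet (J : Set (ZMod (2 * m + 1))) := by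
  have hneg : ∀ j ∈ J, -j ∉ J := by
    intro j hj hj'
    have h1 := hJ.card_pair j hj
    rw [Finset.inter_eq_left.2 (by simp [Finset.insert_subset_iff, hj, hj'])] at h1
    have h2 : j = -j := by
      by_contra h
      rw [Finset.card_pair h] at h1
      omega
    refine hJ.zero_notMem ?_
    -- The modulus is odd, so `j = -j` forces `j = 0`.
    have h3 : ((2 * m + 1 : ℕ) : ZMod (2 * m + 1)) = 0 := ZMod.natCast_self _
    have h4 : j = 0 := by
      push_cast at h3
      linear_combination j * h3 - m * h2
    exact h4 ▸ hj
  refine ⟨hJ.zero_notMem, hneg, fun x hx => ?_⟩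
  have hdisj : Disjoint J (J.image Neg.neg) := by
    rw [Finset.disjoint_left]
    intro y hy hy'
    obtain ⟨z, hz, rfl⟩ := Finset.mem_image.1 hy'
    exact hneg z hz hy
  have h0 : (0 : ZMod (2 * m + 1)) ∉ J ∪ J.image Neg.neg := by
    simp [hJ.zero_notMem]
  have huniv : insert 0 (J ∪ J.image Neg.neg) = Finset.univ := by
    rw [← Finset.card_eq_iff_eq_univ, Finset.card_insert_of_notMem h0,
      Finset.card_union_of_disjoint hdisj, Finset.card_image_of_injective _ neg_injective,
      hJ.card_eq, ZMod.card]
    ring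
  have := huniv ▸ Finset.mem_univ x
  simp only [Finset.mem_insert, hx, Finset.mem_union, Finset.mem_image, false_or] at this
  rcases this with h | ⟨y, hy, rfl⟩
  · exact Or.inl h
  · exact Or.inr (by simpa using hy)

/-- Isomorphic factors have isomorphic compositions. -/
def composeIso {V V' W W' : Type*} {D : Digraph V} {D' : Digraph V'} {F : Digraph W}
    {F' : Digraph W'} (e₁ : D.Adj ≃r D'.Adj) (e₂ : F.Adj ≃r F'.Adj) :
    (D.compose F).Adj ≃r (D'.compose F').Adj where
  toEquiv := e₁.toEquiv.prodCongr e₂.toEquiv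
  map_rel_iff' := by
    rintro ⟨a, b⟩ ⟨c, d⟩
    simp [compose, e₁.map_rel_iff, e₂.map_rel_iff]

/-- `D` is isomorphic to a Cayley tournament of a nontrivial finite abelian group. -/
def IsAbelianCayley {V : Type*} (D : Digraph V) : Prop :=
  ∃ (G : Type) (_ : AddCommGroup G) (_ : Finite G) (_ : Nontrivial G) (J : Set G),
    IsTournamentSet J ∧ Nonempty (D.Adj ≃r (cayley J).Adj)

theorem IsAbelianCayley.compose {V W : Type*} {D : Digraph V} {F : Digraph W}
    (hD : D.IsAbelianCayley) (hF : F.IsAbelianCayley) : (D.compose F).IsAbelianCayley := by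
  obtain ⟨G₁, _, _, _, J₁, h₁, ⟨e₁⟩⟩ := hD
  obtain ⟨G₂, _, _, _, J₂, h₂, ⟨e₂⟩⟩ := hF
  refine ⟨G₁ × G₂, inferInstance, inferInstance, inferInstance, _, h₁.prod h₂,
    ⟨(composeIso e₁ e₂).trans ⟨Equiv.refl _, ?_⟩⟩⟩
  rintro ⟨a, b⟩ ⟨c, d⟩
  simp [cayley, Digraph.compose, sub_eq_zero, eq_comm]

theorem IsGeneratedByCirculants.isAbelianCayley {V : Type} {D : Digraph V}
    (hD : D.IsGeneratedByCirculants) : D.IsAbelianCayley := by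
  induction hD with
  | circulant m hm J hJ =>
    have : Fact (1 < 2 * m + 1) := ⟨by omega⟩
    exact ⟨ZMod (2 * m + 1), inferInstance, inferInstance, inferInstance, J, hJ.isTournamentSet,
      ⟨RelIso.refl _⟩⟩
  | compose D F _ _ hD hF => exact hD.compose hF

/-! ### Colourings, partitions and keenness -/

section Keen

variable {V : Type*} {D : Digraph V}

theorem IsRainbowFree.isExternallyC3Free_ker {α : Type*} {f : V → α} (hf : D.IsRainbowFree f) :
    D.IsExternallyC3Free (Setoid.ker f) := by
  rintro ⟨x, y, z, -, -, -, ⟨h1, n1⟩, ⟨h2, n2⟩, ⟨h3, n3⟩⟩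
  rcases hf x y z h1 h2 h3 with h | h | h
  · exact n1 h
  · exact n2 h
  · exact n3 h

/-- An arc of `D` joining different components must belong to `S`, so a rainbow triangle would lie
in `S`. -/
theorem isRainbowFree_connectedComponentMk {S : Digraph V} (hS : S.IsC3Free) :
    D.IsRainbowFree (D \ S).toSimpleGraphInclusive.connectedComponentMk := by
  intro x y z h1 h2 h3
  by_contra! hcon
  have key : ∀ a b, D.Adj a b → (D \ S).toSimpleGraphInclusive.connectedComponentMk a ≠
      (D \ S).toSimpleGraphInclusive.connectedComponentMk b → a ≠ b ∧ S.Adj a b := by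
    intro a b hab hne
    have hab' : a ≠ b := fun h => hne (by rw [h])
    refine ⟨hab', ?_⟩
    by_contra hS
    refine hne (SimpleGraph.ConnectedComponent.connectedComponentMk_eq_of_adj ?_)
    exact ⟨hab', Or.inl ⟨hab, hS⟩⟩
  have k1 := key _ _ h1 hcon.1
  have k2 := key _ _ h2 hcon.2.1
  have k3 := key _ _ h3 hcon.2.2
  exact hS ⟨x, y, z, k1.1, k2.1, k3.1, k1.2, k2.2, k3.2⟩

theorem card_quotient_le [Finite V] (π : Setoid V) :
    Nat.card (Quotient π) ≤
      Nat.card (D \ D.externalArcs π).toSimpleGraphInclusive.ConnectedComponent := by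
  have hadj : ∀ x y, (D \ D.externalArcs π).toSimpleGraphInclusive.Adj x y →
      Quotient.mk π x = Quotient.mk π y := by
    rintro x y ⟨-, ⟨h, hn⟩ | ⟨h, hn⟩⟩
    · exact Quotient.sound (by_contra fun hc => hn ⟨h, hc⟩)
    · exact (Quotient.sound (by_contra fun hc => hn ⟨h, hc⟩)).symm
  have hwalk : ∀ x y, (D \ D.externalArcs π).toSimpleGraphInclusive.Reachable x y →
      Quotient.mk π x = Quotient.mk π y := by
    rintro x y ⟨p⟩
    induction p with
    | nil => rfl
    | cons h _ ih => exact (hadj _ _ h).trans ih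
  have : Finite (D \ D.externalArcs π).toSimpleGraphInclusive.ConnectedComponent :=
    Quot.finite _
  refine Nat.card_le_card_of_surjective
    (SimpleGraph.ConnectedComponent.lift (Quotient.mk π) fun v w p _ => hwalk v w ⟨p⟩) ?_
  rintro ⟨x⟩
  exact ⟨SimpleGraph.connectedComponentMk _ x, rfl⟩

theorem ncard_classes (π : Setoid V) : π.classes.ncard = Nat.card (Quotient π) := by
  rw [← Nat.card_coe_set_eq]
  exact (Nat.card_congr (Setoid.quotientEquivClasses π)).symm

theorem HasSingularOptimum.omega3_eq [Finite V] {k : ℕ} (h : D.HasSingularOptimum k) :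
    D.omega3 = k := by
  have hle : ∀ S : Digraph V, S.IsC3Free →
      Nat.card (D \ S).toSimpleGraphInclusive.ConnectedComponent ≤ k := by
    intro S hS
    have h1 := h.ncard_range_le (isRainbowFree_connectedComponentMk (D := D) hS)
    rwa [Set.range_eq_univ.2 fun c => c.exists_rep, Set.ncard_univ] at h1
  refine IsGreatest.csSup_eq ⟨?_, ?_⟩
  · obtain ⟨f, hf, hk, -⟩ := h.exists_coloring
    have hker := hf.isExternallyC3Free_ker
    refine ⟨D.externalArcs (Setoid.ker f), fun x y h => h.1, hker, le_antisymm ?_ (hle _ hker)⟩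
    refine le_trans (le_of_eq ?_) (card_quotient_le (D := D) (Setoid.ker f))
    rw [← hk, ← Nat.card_coe_set_eq]
    exact Nat.card_congr (Setoid.quotientKerEquivRange f).symm
  · rintro _ ⟨S, -, hS, rfl⟩
    exact hle S hS

/-- The arc between two singular vertices lies in a directed triangle, all of whose arcs are then
external. -/
theorem IsTriangularTournament.singularClasses_subsingleton (hD : D.IsTriangularTournament)
    {π : Setoid V} (hπ : D.IsExternallyC3Free π) : (singularClasses π).Subsingleton := by
  have hsing : ∀ v, ({v} : Set V) ∈ π.classes → ∀ u, π u v → u = v := by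
    intro v hv u huv
    obtain ⟨w, hw⟩ := hv
    have hvw : v ∈ {x | π x w} := hw ▸ Set.mem_singleton v
    have : u ∈ {x | π x w} := π.trans huv hvw
    rw [← hw] at this
    exact this
  have key : ∀ u v, D.Adj u v → (∀ w, π w u → w = u) → (∀ w, π w v → w = v) → False := by
    intro u v huv hu hv
    obtain ⟨w, hvw, hwu⟩ := hD.exists_triangle u v huv
    refine hπ ⟨u, v, w, hD.ne huv, hD.ne hvw, hD.ne hwu, ⟨huv, fun h => ?_⟩, ⟨hvw, fun h => ?_⟩,
      ⟨hwu, fun h => ?_⟩⟩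
    · exact hD.ne huv (hv u h)
    · exact hD.ne hvw (hv w (π.symm h)).symm
    · exact hD.ne hwu (hu w h)
  rintro _ ⟨hu, u, rfl⟩ _ ⟨hv, v, rfl⟩
  by_contra hne
  have huv : u ≠ v := fun h => hne (by rw [h])
  rcases hD.total u v huv with h | h
  · exact key u v h (hsing u hu) (hsing v hv)
  · exact key v u h (hsing v hv) (hsing u hu)

theorem IsTriangularTournament.isOmega3Keen [Finite V] (hD : D.IsTriangularTournament) {k : ℕ}
    (h : D.HasSingularOptimum k) : D.IsOmega3Keen := by
  have hle : ∀ π : Setoid V, D.IsExternallyC3Free π → (singularClasses π).ncard ≤ 1 := fun π hπ =>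
    Set.ncard_le_one_iff_subsingleton.2 (hD.singularClasses_subsingleton hπ)
  refine ⟨?_, hle⟩
  obtain ⟨f, hf, hk, v, hv⟩ := h.exists_coloring
  have hker := hf.isExternallyC3Free_ker
  refine ⟨Setoid.ker f, ⟨hker, ?_⟩, le_antisymm (hle _ hker) ?_⟩
  · rw [ncard_classes, h.omega3_eq, ← hk, ← Nat.card_coe_set_eq]
    exact Nat.card_congr (Setoid.quotientKerEquivRange f)
  · refine (Set.ncard_pos (Set.toFinite _)).2 ⟨{v}, ⟨v, ?_⟩, v, rfl⟩
    ext u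
    exact ⟨fun hu => by rw [Set.mem_singleton_iff.1 hu]; exact (Setoid.ker f).refl v, hv u⟩

end Keen

theorem IsAbelianCayley.isOmega3Keen {V : Type*} {D : Digraph V} (hD : D.IsAbelianCayley) :
    D.IsOmega3Keen := by
  obtain ⟨G, _, _, _, J, hJ, ⟨e⟩⟩ := hD
  have : Finite V := Finite.of_equiv G e.symm.toEquiv
  obtain ⟨k, hk⟩ := IsTournamentSet.exists_hasSingularOptimum (Nat.card G) G J hJ rfl
  exact (hJ.isTriangularTournament.of_iso e).isOmega3Keen (hk.of_iso e)

end Digraph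

theorem mainTheorem10 {V : Type*} (T : Digraph V) (hT : T.IsCompositionOfCirculants) :
    T.IsOmega3Keen := by
  obtain ⟨X, Y, D, F, hD, hF, ⟨e⟩⟩ := hT
  obtain ⟨G, i₁, i₂, i₃, J, hJ, ⟨e'⟩⟩ := hD.isAbelianCayley.compose hF.isAbelianCayley
  exact Digraph.IsAbelianCayley.isOmega3Keen ⟨G, i₁, i₂, i₃, J, hJ, ⟨e.trans e'⟩⟩
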